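/- **Setting.** Let $K, R^0\ge 0$ be fixed integers and $\beta^0\in\mathbb R^K$. For sample sizes $(N,T)$ let $$Y=\sum_{k=1}^K\beta^0_kX_k+\lambda^0f^{0\prime}+e ,$$ where $Y,X_1,\dots,X_K,e$ are random $N\times T$ matrices and $\lambda^0$ ($N\times R^0$), $f^0$ ($T\times R^0$) are matrices, which may be random or non-random. The limit is taken along any sequence of sample sizes with $N,T\to\infty$ and $N/T\to\kappa^2$, $0<\kappa<\infty$. For each element of the sequence the data may live on a different probability space. "wpa1" means with probability approaching one. For vectors $\|\cdot\|$ is the Euclidean norm, for matrices the spectral norm, and $\|A\|_{HS}^2=\mathrm{Tr}(AA')$. $\mu_r(\cdot)$ is the $r$-th largest eigenvalue, $\alpha\cdot X=\sum_k\alpha_kX_k$, and $M_A=\mathbb 1-A(A'A)^\dagger A'$. For a random or deterministic rate $r\ge 0$, $Z=O_P(r)$ means that for every $\epsilon>0$ there is $M$ with $P(\|Z\|>Mr)\le\epsilon$ for all large sample sizes, and $Z=o_P(r)$ means $P(\|Z\|>\epsilon r)\to0$ for every $\epsilon>0$. The least squares estimator $\widehat\beta_{R^0}$ is (almost surely, whenever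 a minimizer exists) the $\beta$-component of a global minimizer of $\|Y-\beta\cdot X-\Lambda F'\|_{HS}^2$ over $\beta\in\mathbb R^K$, $\Lambda\in\mathbb R^{N\times R^0}$, $F\in\mathbb R^{T\times R^0}$. **Assumptions.** - (SF) $\frac1N\lambda^{0\prime}\lambda^0$ and $\frac1Tf^{0\prime}f^0$ converge in probability to positive definite non-random $R^0\times R^0$ matrices. - (SN) $\|X_k\|=O_P(\sqrt{NT})$ for $k=1,\dots,K$, and $\|e\|=O_P(\sqrt{\max(N,T)})$. - (EX) $\frac1{\sqrt{NT}}\mathrm{Tr}(X_ke')=O_P(1)$ for $k=1,\dots,K$. - (NC) There is a constant $b>0$ such that, wpa1, $\displaystyle\sum_{r=2R^0+1}^{T}\mu_r\Big[\frac{(\alpha\cdot X)'(\alpha\cdot X)}{NT}\Big]\ge b$ for all $\alpha\in\mathbb R^K$ with $\|\alpha\|=1$. **Notation.** Let $W$ be the $K\times K$ matrix and $C^{(1)},C^{(2)}$ the $K$-vectors with elements $$W_{k_1k_2}=\tfrac1{NT}\mathrm{Tr}(M_{\lambda^0}X_{k_1}M_{f^0}X_{k_2}'),\qquad C^{(1)}_k=\tfrac1{\sqrt{NT}}\mathrm{Tr}(M_{\lambda^0}X_kM_{f^0}e'),$$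 $$\begin{aligned}C^{(2)}_k=-\tfrac1{\sqrt{NT}}\Big[&\mathrm{Tr}\big(eM_{f^0}e'M_{\lambda^0}X_kf^0(f^{0\prime}f^0)^{-1}(\lambda^{0\prime}\lambda^0)^{-1}\lambda^{0\prime}\big)\\&+\mathrm{Tr}\big(e'M_{\lambda^0}eM_{f^0}X_k'\lambda^0(\lambda^{0\prime}\lambda^0)^{-1}(f^{0\prime}f^0)^{-1}f^{0\prime}\big)\\&+\mathrm{Tr}\big(e'M_{\lambda^0}X_kM_{f^0}e'\lambda^0(\lambda^{0\prime}\lambda^0)^{-1}(f^{0\prime}f^0)^{-1}f^{0\prime}\big)\Big].\end{aligned}$$ (By SF the matrices $\lambda^{0\prime}\lambda^0$ and $f^{0\prime}f^0$ are invertible wpa1.) **Claim.** Under SF, SN, EX and NC, $W$ is invertible wpa1 and $$\sqrt{NT}\,(\widehat\beta_{R^0}-\beta^0)=W^{-1}\big(C^{(1)}+C^{(2)}\big)+o_P\big(1+\|C^{(1)}\|\big).$$ If furthermore $C^{(1)}=O_P(1)$, then $$\sqrt{NT}\,(\widehat\beta_{R^0}-\beta^0)=W^{-1}\big(C^{(1)}+C^{(2)}\big)+o_P(1)=O_P(1).$$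 -/

import Mathlib

open MeasureTheory Filter Topology
open scoped Matrix

namespace Panel

/-! ### Stochastic order symbols

The `n`-th element of the asymptotic sequence lives on its own probability space `(Ω n, μ n)`.
Every statement bounds the probability of the exceptional event. For a measurable event `A n`,
the condition `P (A n)ᶜ → 0` is the same as `P (A n) → 1`. -/

section Prob

variable {Ω : ℕ → Type*} [∀ n, MeasurableSpace (Ω n)]

/-- `A n` holds with probability approaching one. -/
def WPA1 (μ : ∀ n, Measure (Ω n)) (A : ∀ n, Ω n → Prop) : Prop :=
  Tendsto (fun n => (μ n).real {ω | ¬ A n ω}) atTop (𝓝 0)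

/-- `Z = O_P(r)`: for every `ε > 0` there is an `M` with `P(|Z_n| > M r_n) ≤ ε` for all large `n`.
The rate `r` may be random. -/
def IsBigOP (μ : ∀ n, Measure (Ω n)) (Z r : ∀ n, Ω n → ℝ) : Prop :=
  ∀ ε > (0 : ℝ), ∃ M : ℝ, ∀ᶠ n in atTop, (μ n).real {ω | M * r n ω < |Z n ω|} ≤ ε

/-- `Z = o_P(r)`: for every `ε > 0`, `P(|Z_n| > ε r_n) → 0`. The rate `r` may be random. -/
def IsLittleOP (μ : ∀ n, Measure (Ω n)) (Z r : ∀ n, Ω n → ℝ) : Prop :=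
  ∀ ε > (0 : ℝ), Tendsto (fun n => (μ n).real {ω | ε * r n ω < |Z n ω|}) atTop (𝓝 0)

end Prob

/-! ### Matrix notions -/

section Mat

/-- The Euclidean norm of a vector. -/
noncomputable def vecNorm {K : ℕ} (v : Fin K → ℝ) : ℝ := ‖WithLp.toLp 2 v‖

open scoped Matrix.Norms.L2Operator in
/-- The spectral norm (the operator norm with respect to the Euclidean norms). -/
noncomputable def specNorm {m n : ℕ} (A : Matrix (Fin m) (Fin n) ℝ) : ℝ := ‖A‖

/-- The squared Hilbert-Schmidt (Frobenius) norm `Tr (A A')`. -/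
def hsNormSq {m n : ℕ} (A : Matrix (Fin m) (Fin n) ℝ) : ℝ := (A * Aᵀ).trace

/-- The Moore-Penrose inverse of `A' A`: reciprocals are taken of its nonzero eigenvalues, and the
eigenvalue `0` is kept. It is the inverse when `A' A` is invertible. -/
noncomputable def gramPinv {m n : ℕ} (A : Matrix (Fin m) (Fin n) ℝ) :
    Matrix (Fin n) (Fin n) ℝ :=
  cfc (fun x : ℝ => x⁻¹) (Aᵀ * A)

/-- `M_A = 1 - A (A' A)^† A'`. -/
noncomputable def annih {m n : ℕ} (A : Matrix (Fin m) (Fin n) ℝ) :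
    Matrix (Fin m) (Fin m) ℝ :=
  1 - A * gramPinv A * Aᵀ

/-- `α · X = ∑ₖ αₖ Xₖ`. -/
def linComb {K N T : ℕ} (α : Fin K → ℝ) (X : Fin K → Matrix (Fin N) (Fin T) ℝ) :
    Matrix (Fin N) (Fin T) ℝ :=
  ∑ k, α k • X k

/-- `A' A / (N T)` for an `N × T` matrix `A`. -/
noncomputable def normGram {N T : ℕ} (A : Matrix (Fin N) (Fin T) ℝ) :
    Matrix (Fin T) (Fin T) ℝ :=
  (1 / ((N : ℝ) * T)) • (Aᵀ * A)

theorem normGram_isHermitian {N T : ℕ} (A : Matrix (Fin N) (Fin T) ℝ) :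
    (normGram A).IsHermitian := by
  unfold normGram Matrix.IsHermitian
  simp [Matrix.conjTranspose_eq_transpose_of_trivial, Matrix.transpose_smul,
    Matrix.transpose_mul]

/-- `∑_{r = q+1}^{T} μ_r [A' A / (N T)]`, where `μ_r` is the `r`-th largest eigenvalue, counted with
multiplicity. Mathlib's `eigenvalues₀` are in decreasing order and indexed from `0`. -/
noncomputable def tailEig {N T : ℕ} (q : ℕ) (A : Matrix (Fin N) (Fin T) ℝ) : ℝ :=
  ∑ r with q ≤ r.val, (normGram_isHermitian A).eigenvalues₀ r

end Mat

/-! ### The model, the estimator and the terms of the expansion -/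

section Model

variable {K N T R : ℕ}

/-- The outcome `Y = β⁰ · X + λ⁰ f⁰' + e`. -/
def outcome (β₀ : Fin K → ℝ) (X : Fin K → Matrix (Fin N) (Fin T) ℝ)
    (lam : Matrix (Fin N) (Fin R) ℝ) (f : Matrix (Fin T) (Fin R) ℝ)
    (e : Matrix (Fin N) (Fin T) ℝ) : Matrix (Fin N) (Fin T) ℝ :=
  linComb β₀ X + lam * fᵀ + e

/-- `β` is a least squares estimate with `R` factors: for some `Λ`, `F` the triple `(β, Λ, F)` is a
global minimizer of `‖Y - β · X - Λ F'‖²_HS`. -/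
def IsLSEstimate (R : ℕ) (Y : Matrix (Fin N) (Fin T) ℝ)
    (X : Fin K → Matrix (Fin N) (Fin T) ℝ) (β : Fin K → ℝ) : Prop :=
  ∃ (L : Matrix (Fin N) (Fin R) ℝ) (F : Matrix (Fin T) (Fin R) ℝ),
    ∀ (β' : Fin K → ℝ) (L' : Matrix (Fin N) (Fin R) ℝ) (F' : Matrix (Fin T) (Fin R) ℝ),
      hsNormSq (Y - linComb β X - L * Fᵀ) ≤ hsNormSq (Y - linComb β' X - L' * F'ᵀ)

/-- `W_{k₁ k₂} = (1 / NT) Tr (M_λ X_{k₁} M_f X_{k₂}')`. -/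
noncomputable def Wmat (X : Fin K → Matrix (Fin N) (Fin T) ℝ)
    (lam : Matrix (Fin N) (Fin R) ℝ) (f : Matrix (Fin T) (Fin R) ℝ) :
    Matrix (Fin K) (Fin K) ℝ :=
  Matrix.of fun k₁ k₂ =>
    1 / ((N : ℝ) * T) * (annih lam * X k₁ * annih f * (X k₂)ᵀ).trace

/-- `C⁽¹⁾_k = (1 / √(NT)) Tr (M_λ X_k M_f e')`. -/
noncomputable def C1 (X : Fin K → Matrix (Fin N) (Fin T) ℝ)
    (lam : Matrix (Fin N) (Fin R) ℝ) (f : Matrix (Fin T) (Fin R) ℝ)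
    (e : Matrix (Fin N) (Fin T) ℝ) : Fin K → ℝ :=
  fun k => 1 / √((N : ℝ) * T) * (annih lam * X k * annih f * eᵀ).trace

/-- The term `C⁽²⁾`, which is quadratic in `e`. -/
noncomputable def C2 (X : Fin K → Matrix (Fin N) (Fin T) ℝ)
    (lam : Matrix (Fin N) (Fin R) ℝ) (f : Matrix (Fin T) (Fin R) ℝ)
    (e : Matrix (Fin N) (Fin T) ℝ) : Fin K → ℝ :=
  fun k => -(1 / √((N : ℝ) * T) *
    ((e * annih f * eᵀ * annih lam * X k *
        (f * (fᵀ * f)⁻¹ * (lamᵀ * lam)⁻¹ * lamᵀ)).trace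
      + (eᵀ * annih lam * e * annih f * (X k)ᵀ *
        (lam * (lamᵀ * lam)⁻¹ * (fᵀ * f)⁻¹ * fᵀ)).trace
      + (eᵀ * annih lam * X k * annih f * eᵀ *
        (lam * (lamᵀ * lam)⁻¹ * (fᵀ * f)⁻¹ * fᵀ)).trace))

end Model

/-! ### The assumptions -/

section Assumptions

variable {Ω : ℕ → Type*} [∀ n, MeasurableSpace (Ω n)] {K R : ℕ} {N T : ℕ → ℕ}

/-- `plim A' A / m` exists and is a (nonrandom) positive definite matrix, where `A` has `m` rows. -/
def StrongGram (μ : ∀ n, Measure (Ω n)) {m : ℕ → ℕ}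
    (A : ∀ n, Ω n → Matrix (Fin (m n)) (Fin R) ℝ) : Prop :=
  ∃ S : Matrix (Fin R) (Fin R) ℝ, S.PosDef ∧
    IsLittleOP μ (fun n ω => specNorm ((1 / (m n : ℝ)) • ((A n ω)ᵀ * A n ω) - S))
      (fun _ _ => 1)

/-- Strong factors. -/
def AssumptionSF (μ : ∀ n, Measure (Ω n))
    (lam : ∀ n, Ω n → Matrix (Fin (N n)) (Fin R) ℝ)
    (f : ∀ n, Ω n → Matrix (Fin (T n)) (Fin R) ℝ) : Prop :=
  StrongGram μ lam ∧ StrongGram μ f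

/-- `‖X_k‖ = O_P(√(NT))` for every `k`, and `‖e‖ = O_P(√(max(N,T)))`. -/
def AssumptionSN (μ : ∀ n, Measure (Ω n))
    (X : ∀ n, Ω n → Fin K → Matrix (Fin (N n)) (Fin (T n)) ℝ)
    (e : ∀ n, Ω n → Matrix (Fin (N n)) (Fin (T n)) ℝ) : Prop :=
  (∀ k, IsBigOP μ (fun n ω => specNorm (X n ω k)) (fun n _ => √((N n : ℝ) * T n))) ∧
    IsBigOP μ (fun n ω => specNorm (e n ω)) (fun n _ => √(max (N n : ℝ) (T n)))

/-- `(1 / √(NT)) Tr (X_k e') = O_P(1)` for every `k`. -/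
def AssumptionEX (μ : ∀ n, Measure (Ω n))
    (X : ∀ n, Ω n → Fin K → Matrix (Fin (N n)) (Fin (T n)) ℝ)
    (e : ∀ n, Ω n → Matrix (Fin (N n)) (Fin (T n)) ℝ) : Prop :=
  ∀ k, IsBigOP μ
    (fun n ω => 1 / √((N n : ℝ) * T n) * (X n ω k * (e n ω)ᵀ).trace) (fun _ _ => 1)

/-- Non-collinearity with `R` estimated and `R₀` true factors: for some `b > 0`, wpa1,
`min_{‖α‖ = 1} ∑_{r = R + R₀ + 1}^{T} μ_r [(α·X)' (α·X) / (NT)] ≥ b`. -/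
def AssumptionNC (μ : ∀ n, Measure (Ω n)) (R R₀ : ℕ)
    (X : ∀ n, Ω n → Fin K → Matrix (Fin (N n)) (Fin (T n)) ℝ) : Prop :=
  ∃ b > (0 : ℝ), WPA1 μ fun n ω =>
    ∀ α : Fin K → ℝ, vecNorm α = 1 → b ≤ tailEig (R + R₀) (linComb α (X n ω))

end Assumptions

end Panel

/-! Let `s = √(NT)`, `V = (β̂ - β⁰)·X`, `E = e - V`, `D = λ⁰f⁰' - ΛF'`, and let `U = E + D` be the
least squares residual. Minimality gives `Λ'U = 0`, `UF = 0` and the score equations `Tr(X_k'U) =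
0`. The expansion is the score equation with `U` expanded to second order around the signal `λ⁰f⁰'`.

Preliminary rate. Comparing the objective with its value at `(β⁰, λ⁰, f⁰)` and using that `D` has
rank at most `2R`, noncollinearity forces `s‖β̂ - β⁰‖ = O(√s)` (`preliminary_rate`). Hence `‖E‖ =
O(√s)`, and comparing at fixed `β̂` gives `‖D‖ = O(√s)` as well. By strong factors the pseudoinverse
`B` of the signal has norm `O(1/s)`, so `‖B‖‖D‖` is small.

Expansion of the residual. No perturbation series for eigenvalues is needed. With `P`, `Q` the
projections on the factor spaces, the two orthogonality relations and a generalized inverse of `ΛF'`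
yield exact identities, which show that `U` equals `(1-P)E(1-Q)` minus a quadratic term up to a
cubic error of norm `O(‖B‖²s^(3/2)) = O(s^(-1/2))` (`norm_remainder_le`). The error also has rank at
most `7R`, so its trace against `X_k` is bounded by rank times spectral norms
(`abs_trace_transpose_mul_le`).

Conclusion. Pairing with `X_k` and dividing by `s`, the linear term gives `C⁽¹⁾ - Wz` with `z = s(β̂
- β⁰)`, the quadratic term gives `C⁽²⁾` after replacing `E` by `e`, and the total error is `O((1 +
‖z‖)/√s)` (`score_expansion`). Noncollinearity bounds `W` below by `b`, so the `‖z‖` in the error is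
absorbed and `W` is inverted (`exists_expansion_constants`). All this is deterministic on samples
satisfying `RegularSample`, which have probability at least `1 - ε` eventually
(`exists_regularSample`). -/

set_option linter.unusedSectionVars false

namespace Panel

/-! ### Rank, trace and spectral norm -/

section MatrixLemmas

open scoped Matrix.Norms.L2Operator

variable {m n l : Type*} [Fintype m] [Fintype n] [Fintype l]
  [DecidableEq m] [DecidableEq n] [DecidableEq l]

theorem norm_transpose (A : Matrix m n ℝ) : ‖Aᵀ‖ = ‖A‖ := by
  rw [← Matrix.conjTranspose_eq_transpose_of_trivial, Matrix.l2_opNorm_conjTranspose]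

theorem norm_transpose_mul_self (A : Matrix m n ℝ) : ‖Aᵀ * A‖ = ‖A‖ * ‖A‖ := by
  rw [← Matrix.conjTranspose_eq_transpose_of_trivial, Matrix.l2_opNorm_conjTranspose_mul_self]

theorem norm_mul_le_of_le {A : Matrix m n ℝ} {B : Matrix n l ℝ} {a b : ℝ}
    (hA : ‖A‖ ≤ a) (hB : ‖B‖ ≤ b) : ‖A * B‖ ≤ a * b :=
  (Matrix.l2_opNorm_mul A B).trans
    (mul_le_mul hA hB (norm_nonneg _) ((norm_nonneg _).trans hA))

theorem rank_add_le (A B : Matrix m n ℝ) : (A + B).rank ≤ A.rank + B.rank := by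
  unfold Matrix.rank
  rw [Matrix.mulVecLin_add]
  refine (Submodule.finrank_mono (LinearMap.range_add_le A.mulVecLin B.mulVecLin)).trans ?_
  exact Submodule.finrank_add_le_finrank_add_finrank _ _

theorem rank_neg_eq (A : Matrix m n ℝ) : (-A).rank = A.rank := by
  unfold Matrix.rank
  have : (-A).mulVecLin = - A.mulVecLin := by ext; simp
  rw [this, LinearMap.range_neg]

theorem rank_add_le_of_le {A B : Matrix m n ℝ} {a b : ℕ} (hA : A.rank ≤ a) (hB : B.rank ≤ b) :
    (A + B).rank ≤ a + b :=
  (rank_add_le A B).trans (add_le_add hA hB)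

theorem rank_sub_le_of_le {A B : Matrix m n ℝ} {a b : ℕ} (hA : A.rank ≤ a) (hB : B.rank ≤ b) :
    (A - B).rank ≤ a + b := by
  rw [sub_eq_add_neg]
  exact rank_add_le_of_le hA ((rank_neg_eq B).le.trans hB)

theorem abs_eigenvalues_le_norm {A : Matrix n n ℝ} (hA : A.IsHermitian) (i : n) :
    |hA.eigenvalues i| ≤ ‖A‖ := by
  have h := Matrix.l2_opNorm_mulVec A (hA.eigenvectorBasis i)
  rw [hA.mulVec_eigenvectorBasis i] at h
  have h1 : ‖hA.eigenvectorBasis i‖ = 1 := hA.eigenvectorBasis.orthonormal.1 i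
  rw [h1, mul_one] at h
  have h2 : (EuclideanSpace.equiv n ℝ).symm (hA.eigenvalues i • (hA.eigenvectorBasis i).ofLp)
      = hA.eigenvalues i • hA.eigenvectorBasis i := by
    ext j; simp
  rw [h2, norm_smul, h1, mul_one] at h
  exact h

theorem abs_trace_le_of_isHermitian {A : Matrix n n ℝ} (hA : A.IsHermitian) :
    |A.trace| ≤ A.rank * ‖A‖ := by
  classical
  rw [hA.trace_eq_sum_eigenvalues, hA.rank_eq_card_non_zero_eigs, Fintype.card_subtype]
  refine (Finset.abs_sum_le_sum_abs _ _).trans ?_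
  rw [← Finset.sum_filter_add_sum_filter_not Finset.univ (fun i => hA.eigenvalues i ≠ 0)]
  rw [Finset.sum_eq_zero (s := Finset.univ.filter fun i => ¬ hA.eigenvalues i ≠ 0), add_zero,
    ← nsmul_eq_mul]
  · exact Finset.sum_le_card_nsmul _ _ _ fun i _ => abs_eigenvalues_le_norm hA i
  · intro i hi
    simp at hi
    simp [hi]

/-- Reduces to the symmetric case, where the trace is a sum of at most rank-many nonzero
eigenvalues. Symmetrizing to `A + Aᵀ` doubles the trace, but may double both rank and norm, whence
the factor 2. -/
theorem abs_trace_le (A : Matrix n n ℝ) : |A.trace| ≤ 2 * A.rank * ‖A‖ := by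
  have hH : (A + Aᵀ).IsHermitian := by
    simp [Matrix.IsHermitian, Matrix.conjTranspose_eq_transpose_of_trivial, add_comm]
  have h := abs_trace_le_of_isHermitian hH
  rw [Matrix.trace_add, Matrix.trace_transpose, ← two_mul, abs_mul, abs_two] at h
  have h1 : ((A + Aᵀ).rank : ℝ) ≤ 2 * A.rank := by
    have := rank_add_le A Aᵀ
    rw [Matrix.rank_transpose] at this
    exact_mod_cast this.trans (by omega)
  have h2 : ‖A + Aᵀ‖ ≤ 2 * ‖A‖ := by
    refine (norm_add_le _ _).trans ?_
    rw [norm_transpose]; linarith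
  have := mul_le_mul h1 h2 (norm_nonneg _) (by positivity)
  linarith

/-- The trace pairing of a matrix with one of rank at most `r`. -/
theorem abs_trace_transpose_mul_le (A B : Matrix m n ℝ) {r : ℕ} (hr : B.rank ≤ r) :
    |(Aᵀ * B).trace| ≤ 2 * r * (‖A‖ * ‖B‖) := by
  refine (abs_trace_le _).trans ?_
  have h1 : ((Aᵀ * B).rank : ℝ) ≤ r := by
    exact_mod_cast (Matrix.rank_mul_le_right _ _).trans hr
  have h2 : ‖Aᵀ * B‖ ≤ ‖A‖ * ‖B‖ := norm_mul_le_of_le (norm_transpose A).le le_rfl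
  gcongr

theorem trace_transpose_mul_self_eq (A : Matrix m n ℝ) :
    (Aᵀ * A).trace = ∑ i, ∑ j, A i j ^ 2 := by
  rw [Finset.sum_comm]
  simp [Matrix.trace, Matrix.mul_apply, sq]

theorem trace_transpose_mul_self_nonneg (A : Matrix m n ℝ) : 0 ≤ (Aᵀ * A).trace := by
  rw [trace_transpose_mul_self_eq]; positivity

theorem norm_sq_le_trace (A : Matrix m n ℝ) : ‖A‖ ^ 2 ≤ (Aᵀ * A).trace := by
  have h0 := trace_transpose_mul_self_nonneg A
  have : ‖A‖ ≤ √((Aᵀ * A).trace) := by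
    rw [Matrix.l2_opNorm_def]
    refine ContinuousLinearMap.opNorm_le_bound _ (Real.sqrt_nonneg _) fun x => ?_
    rw [EuclideanSpace.norm_eq, EuclideanSpace.norm_eq, ← Real.sqrt_mul h0]
    refine Real.sqrt_le_sqrt ?_
    rw [trace_transpose_mul_self_eq, Finset.sum_mul]
    refine Finset.sum_le_sum fun i _ => ?_
    have := Finset.sum_mul_sq_le_sq_mul_sq Finset.univ (fun j => A i j) (fun j => x j)
    simpa [Matrix.mulVec, dotProduct] using this
  calc ‖A‖ ^ 2 ≤ √((Aᵀ * A).trace) ^ 2 := by gcongr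
    _ = _ := Real.sq_sqrt h0

end MatrixLemmas

/-! ### Second-order expansion of the residual of a low-rank fit -/

section Expansion

open scoped Matrix.Norms.L2Operator

variable {m n : Type*} [Fintype m] [Fintype n] [DecidableEq m] [DecidableEq n]

theorem norm_le_one_of_idem {P : Matrix n n ℝ} (hs : Pᵀ = P) (hi : P * P = P) : ‖P‖ ≤ 1 := by
  have h := norm_transpose_mul_self P
  rw [hs, hi] at h
  nlinarith [norm_nonneg P]

/-- The second-order term of the residual of a low-rank approximation, as a bilinear form. -/
def quadTerm (P : Matrix m m ℝ) (Q : Matrix n n ℝ) (B : Matrix n m ℝ) (E E' : Matrix m n ℝ) :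
    Matrix m n ℝ :=
  (1 - P) * E * B * E' * (1 - Q) + Bᵀ * Eᵀ * (1 - P) * E' * (1 - Q)
    + (1 - P) * E * (1 - Q) * E'ᵀ * Bᵀ

/-- Perturbation data: the signal `G₀` has spectral projections `P`, `Q` and pseudoinverse `B`; the
low-rank matrix `G₀ - D` has generalized inverse `A`, and it is orthogonal on both sides to the
residual `E + D`. -/
structure LowRankPerturbation (G₀ E D : Matrix m n ℝ) (P : Matrix m m ℝ) (Q : Matrix n n ℝ)
    (B A : Matrix n m ℝ) : Prop where
  P_symm : Pᵀ = P
  P_idem : P * P = P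
  Q_symm : Qᵀ = Q
  Q_idem : Q * Q = Q
  G_mul_B : G₀ * B = P
  B_mul_G : B * G₀ = Q
  Q_mul_B : Q * B = B
  B_mul_P : B * P = B
  P_mul_G : P * G₀ = G₀
  G_mul_Q : G₀ * Q = G₀
  Q_mul_A : Q * A = A
  A_mul_P : A * P = A
  gen_inv : (G₀ - D) * A * (G₀ - D) = G₀ - D
  A_sub_B : A - B = A * D * B
  left_orth : (G₀ - D)ᵀ * (E + D) = 0
  right_orth : (E + D) * (G₀ - D)ᵀ = 0

namespace LowRankPerturbation

variable {G₀ E D : Matrix m n ℝ} {P : Matrix m m ℝ} {Q : Matrix n n ℝ} {B A : Matrix n m ℝ}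

theorem norm_Q_le (h : LowRankPerturbation G₀ E D P Q B A) : ‖Q‖ ≤ 1 :=
  norm_le_one_of_idem h.Q_symm h.Q_idem

theorem norm_one_sub_P_le (h : LowRankPerturbation G₀ E D P Q B A) : ‖1 - P‖ ≤ 1 :=
  norm_le_one_of_idem (by simp [h.P_symm]) (by noncomm_ring [h.P_idem])

theorem norm_one_sub_Q_le (h : LowRankPerturbation G₀ E D P Q B A) : ‖1 - Q‖ ≤ 1 :=
  norm_le_one_of_idem (by simp [h.Q_symm]) (by noncomm_ring [h.Q_idem])

/-- Since `P = Bᵀ * G₀ᵀ`, left orthogonality trades `G₀ᵀ` for `Dᵀ`. The part of the residual in the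
signal's column space is therefore of second order in `E`, `D`. -/
theorem P_mul_res (h : LowRankPerturbation G₀ E D P Q B A) :
    P * (E + D) = Bᵀ * Dᵀ * (E + D) := by
  have h1 := h.left_orth
  rw [Matrix.transpose_sub, Matrix.sub_mul, sub_eq_zero] at h1
  rw [← h.P_symm, ← h.G_mul_B, Matrix.transpose_mul, Matrix.mul_assoc, h1, Matrix.mul_assoc]

theorem res_mul_Q (h : LowRankPerturbation G₀ E D P Q B A) :
    (E + D) * Q = (E + D) * Dᵀ * Bᵀ := by
  have h1 := h.right_orth
  rw [Matrix.transpose_sub, Matrix.mul_sub, sub_eq_zero] at h1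
  rw [← h.Q_symm, ← h.B_mul_G, Matrix.transpose_mul, ← Matrix.mul_assoc, h1]

/-- Compressing `(G₀ - D) * A * (G₀ - D) = G₀ - D` by `1 - P` and `1 - Q` kills every outer `G₀`.
This is the low-rank constraint on `G₀ - D`: the off-signal block of `D` is quadratic in `D`. -/
theorem compl_D_compl (h : LowRankPerturbation G₀ E D P Q B A) :
    (1 - P) * D * (1 - Q) = -((1 - P) * (D * A * D) * (1 - Q)) := by
  have h1 : (1 - P) * (G₀ - D) = -((1 - P) * D) := by
    rw [Matrix.mul_sub, Matrix.sub_mul 1 P G₀, h.P_mul_G, Matrix.one_mul, sub_self, zero_sub]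
  have h2 : (G₀ - D) * (1 - Q) = -(D * (1 - Q)) := by
    rw [Matrix.sub_mul, Matrix.mul_sub G₀, h.G_mul_Q, Matrix.mul_one, sub_self, zero_sub]
  have h3 : (1 - P) * (G₀ - D) * A * ((G₀ - D) * (1 - Q)) = (1 - P) * (G₀ - D) * (1 - Q) := by
    conv_rhs => rw [← h.gen_inv]
    simp only [Matrix.mul_assoc]
  rw [h1, h2] at h3
  simp only [Matrix.neg_mul, Matrix.mul_neg, neg_neg, Matrix.mul_assoc] at h3 ⊢
  rw [h3, neg_neg]

/-- Because `Q * A = A`, a factor `D` next to `A` becomes `-E` up to the second-order term `(E + D)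
* Q`. The next three lemmas are the versions for `B` and for the left side; together they eliminate
the unknown `D` from the leading terms. -/
theorem D_mul_A (h : LowRankPerturbation G₀ E D P Q B A) :
    D * A = ((E + D) * Q - E) * A := by
  rw [Matrix.sub_mul, Matrix.mul_assoc, h.Q_mul_A, Matrix.add_mul, add_sub_cancel_left]

theorem D_mul_B (h : LowRankPerturbation G₀ E D P Q B A) :
    D * B = ((E + D) * Q - E) * B := by
  rw [Matrix.sub_mul, Matrix.mul_assoc, h.Q_mul_B, Matrix.add_mul, add_sub_cancel_left]

theorem A_mul_D (h : LowRankPerturbation G₀ E D P Q B A) :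
    A * D = A * (P * (E + D) - E) := by
  rw [Matrix.mul_sub, ← Matrix.mul_assoc, h.A_mul_P, Matrix.mul_add, add_sub_cancel_left]

theorem B_mul_D (h : LowRankPerturbation G₀ E D P Q B A) :
    B * D = B * (P * (E + D) - E) := by
  rw [Matrix.mul_sub, ← Matrix.mul_assoc, h.B_mul_P, Matrix.mul_add, add_sub_cancel_left]

theorem compl_res_compl (h : LowRankPerturbation G₀ E D P Q B A) :
    E + D = (1 - P) * E * (1 - Q) - (1 - P) * (D * A * D) * (1 - Q)
      + P * (E + D) + (E + D) * Q - P * (E + D) * Q := by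
  rw [sub_eq_add_neg ((1 - P) * E * (1 - Q)), ← h.compl_D_compl]
  simp only [Matrix.mul_sub, Matrix.sub_mul, Matrix.mul_add, Matrix.add_mul, Matrix.mul_one,
    Matrix.one_mul]
  abel

/-- Start from `compl_res_compl` and substitute `-E` for `D` in `D * A * D`, `P * (E + D)` and `(E +
D) * Q`. What is left after removing `quadTerm` contains at least three small factors in each term.
-/
theorem remainder_eq (h : LowRankPerturbation G₀ E D P Q B A) :
    (E + D) - ((1 - P) * E * (1 - Q) - quadTerm P Q B E E) =
      -((1 - P) * ((E + D) * Q * A * (P * (E + D)) - (E + D) * Q * A * E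
          - E * A * (P * (E + D)) + E * (A - B) * E) * (1 - Q))
      + (Bᵀ * ((E + D) * Q)ᵀ * (E + D) - Bᵀ * Eᵀ * ((E + D) - (1 - P) * E * (1 - Q)))
      + ((E + D) * (P * (E + D))ᵀ * Bᵀ - ((E + D) - (1 - P) * E * (1 - Q)) * Eᵀ * Bᵀ)
      - P * (E + D) * Q := by
  have hp : P * (E + D) = Bᵀ * ((E + D) * Q)ᵀ * (E + D) - Bᵀ * Eᵀ * (E + D) := by
    rw [h.P_mul_res, ← Matrix.sub_mul, ← Matrix.mul_sub, ← Matrix.transpose_sub,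
      ← Matrix.transpose_mul, ← Matrix.transpose_mul, h.D_mul_B]
  have hq : (E + D) * Q = (E + D) * (P * (E + D))ᵀ * Bᵀ - (E + D) * Eᵀ * Bᵀ := by
    rw [h.res_mul_Q, ← Matrix.sub_mul, ← Matrix.mul_sub, ← Matrix.transpose_sub,
      Matrix.mul_assoc, Matrix.mul_assoc (E + D), ← Matrix.transpose_mul, ← Matrix.transpose_mul,
      h.B_mul_D]
  have hd : D * A * D = (E + D) * Q * A * (P * (E + D)) - (E + D) * Q * A * E
          - E * A * (P * (E + D)) + E * A * E := by
    rw [h.D_mul_A, Matrix.mul_assoc, h.A_mul_D]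
    simp only [Matrix.mul_sub, Matrix.sub_mul, Matrix.mul_assoc]
    abel
  have hU := h.compl_res_compl
  rw [hd] at hU
  generalize hW : E + D = U at *
  generalize hr : P * U * Q = r at *
  generalize hp' : P * U = p at *
  generalize hq' : U * Q = q at *
  unfold quadTerm
  have e1 : Bᵀ * Eᵀ * (U - (1 - P) * E * (1 - Q))
      = Bᵀ * Eᵀ * U - Bᵀ * Eᵀ * (1 - P) * E * (1 - Q) := by
    rw [Matrix.mul_sub]; simp only [Matrix.mul_assoc]
  have e2 : (U - (1 - P) * E * (1 - Q)) * Eᵀ * Bᵀ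
      = U * Eᵀ * Bᵀ - (1 - P) * E * (1 - Q) * Eᵀ * Bᵀ := by
    rw [Matrix.sub_mul, Matrix.sub_mul]
  have e3 : (1 - P) * (q * A * p - q * A * E - E * A * p + E * (A - B) * E) * (1 - Q)
      = (1 - P) * (q * A * p - q * A * E - E * A * p + E * A * E) * (1 - Q)
        - (1 - P) * E * B * E * (1 - Q) := by
    have : q * A * p - q * A * E - E * A * p + E * (A - B) * E
        = (q * A * p - q * A * E - E * A * p + E * A * E) - E * B * E := by
      rw [Matrix.mul_sub, Matrix.sub_mul]; abel
    rw [this, Matrix.mul_sub (1 - P) _ (E * B * E), Matrix.sub_mul]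
    simp only [Matrix.mul_assoc]
  rw [e1, e2, e3]
  -- The blocks `p` and `q` each occur once in `hU`, so adding their own expansions replaces them.
  linear_combination (norm := abel) hU + hp + hq

theorem norm_P_mul_res_le (h : LowRankPerturbation G₀ E D P Q B A) {d β : ℝ} (hE : ‖E‖ ≤ d)
    (hD : ‖D‖ ≤ d) (hB : ‖B‖ ≤ β) : ‖P * (E + D)‖ ≤ β * d * (2 * d) := by
  rw [h.P_mul_res]
  refine norm_mul_le_of_le (norm_mul_le_of_le ?_ ?_) ((norm_add_le _ _).trans (by linarith))
  · rwa [norm_transpose]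
  · rwa [norm_transpose]

theorem norm_res_mul_Q_le (h : LowRankPerturbation G₀ E D P Q B A) {d β : ℝ} (hE : ‖E‖ ≤ d)
    (hD : ‖D‖ ≤ d) (hB : ‖B‖ ≤ β) : ‖(E + D) * Q‖ ≤ 2 * d * d * β := by
  rw [h.res_mul_Q]
  refine norm_mul_le_of_le (norm_mul_le_of_le ((norm_add_le _ _).trans (by linarith)) ?_) ?_
  · rwa [norm_transpose]
  · rwa [norm_transpose]

theorem norm_compl_mul_compl_le (h : LowRankPerturbation G₀ E D P Q B A) (Z : Matrix m n ℝ) :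
    ‖(1 - P) * Z * (1 - Q)‖ ≤ ‖Z‖ := by
  have := norm_mul_le_of_le (norm_mul_le_of_le h.norm_one_sub_P_le (le_refl ‖Z‖))
    h.norm_one_sub_Q_le
  simpa using this

/-- The resolvent identity `A = B + A * D * B` gives `‖A‖ ≤ β + ‖A‖ / 2`. -/
theorem norm_A_le (h : LowRankPerturbation G₀ E D P Q B A) {d β : ℝ}
    (hD : ‖D‖ ≤ d) (hB : ‖B‖ ≤ β) (hβ : β * d ≤ 1 / 2) : ‖A‖ ≤ 2 * β := by
  have h1 : ‖A - B‖ ≤ ‖A‖ * d * β := by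
    rw [h.A_sub_B]
    exact norm_mul_le_of_le (norm_mul_le_of_le le_rfl hD) hB
  have h2 : ‖A‖ ≤ ‖A - B‖ + ‖B‖ := by simpa using norm_add_le (A - B) B
  nlinarith [norm_nonneg A, mul_le_mul_of_nonneg_left hβ (norm_nonneg A)]

/-- Second-order expansion of the residual of a low-rank approximation. -/
theorem norm_remainder_le (h : LowRankPerturbation G₀ E D P Q B A) {d β : ℝ} (hE : ‖E‖ ≤ d)
    (hD : ‖D‖ ≤ d) (hB : ‖B‖ ≤ β) (hβ : β * d ≤ 1 / 2) :
    ‖(E + D) - ((1 - P) * E * (1 - Q) - quadTerm P Q B E E)‖ ≤ 40 * β ^ 2 * d ^ 3 := by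
  have hd0 : 0 ≤ d := (norm_nonneg _).trans hE
  have hβ0 : 0 ≤ β := (norm_nonneg _).trans hB
  have hA := h.norm_A_le hD hB hβ
  have hp := h.norm_P_mul_res_le hE hD hB
  have hq := h.norm_res_mul_Q_le hE hD hB
  have hU : ‖E + D‖ ≤ 2 * d := (norm_add_le _ _).trans (by linarith)
  have hBt : ‖Bᵀ‖ ≤ β := by rwa [norm_transpose]
  have hEt : ‖Eᵀ‖ ≤ d := by rwa [norm_transpose]
  have hpt : ‖(P * (E + D))ᵀ‖ ≤ β * d * (2 * d) := by rwa [norm_transpose]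
  have hqt : ‖((E + D) * Q)ᵀ‖ ≤ 2 * d * d * β := by rwa [norm_transpose]
  have hAB : ‖A - B‖ ≤ 2 * β * d * β := by
    rw [h.A_sub_B]
    exact norm_mul_le_of_le (norm_mul_le_of_le hA hD) hB
  have hpq : ‖P * (E + D) * Q‖ ≤ β * d * (2 * d * d * β) := by
    rw [h.P_mul_res, Matrix.mul_assoc]
    refine norm_mul_le_of_le (norm_mul_le_of_le hBt ?_) hq
    rwa [norm_transpose]
  -- The cubic bound `hpq` enters the final sum; this quadratic one only serves `hV`, where every
  -- term is quadratic.
  have hpq' : ‖P * (E + D) * Q‖ ≤ β * d * (2 * d) := by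
    have := norm_mul_le_of_le hp h.norm_Q_le
    rwa [mul_one] at this
  have hDAD : ‖(1 - P) * (D * A * D) * (1 - Q)‖ ≤ d * (2 * β) * d :=
    (h.norm_compl_mul_compl_le _).trans (norm_mul_le_of_le (norm_mul_le_of_le hD hA) hD)
  have hV : ‖(E + D) - (1 - P) * E * (1 - Q)‖ ≤ 8 * β * d ^ 2 := by
    have : (E + D) - (1 - P) * E * (1 - Q) = -((1 - P) * (D * A * D) * (1 - Q))
        + P * (E + D) + (E + D) * Q - P * (E + D) * Q := by
      linear_combination (norm := abel) h.compl_res_compl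
    rw [this]
    refine (norm_sub_le_of_le (norm_add_le_of_le (norm_add_le_of_le ((norm_neg _).trans_le hDAD) hp) hq)
      hpq').trans (le_of_eq (by ring))
  have t1 := (h.norm_compl_mul_compl_le _).trans
    (norm_add_le_of_le (norm_sub_le_of_le (norm_sub_le_of_le
    (norm_mul_le_of_le (norm_mul_le_of_le hq hA) hp)
    (norm_mul_le_of_le (norm_mul_le_of_le hq hA) hE))
    (norm_mul_le_of_le (norm_mul_le_of_le hE hA) hp))
    (norm_mul_le_of_le (norm_mul_le_of_le hE hAB) hE))
  rw [← norm_neg] at t1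
  have t2 := norm_sub_le_of_le (norm_mul_le_of_le (norm_mul_le_of_le hBt hqt) hU)
    (norm_mul_le_of_le (norm_mul_le_of_le hBt hEt) hV)
  have t3 := norm_sub_le_of_le (norm_mul_le_of_le (norm_mul_le_of_le hU hpt) hBt)
    (norm_mul_le_of_le (norm_mul_le_of_le hV hEt) hBt)
  rw [h.remainder_eq]
  refine (norm_sub_le_of_le (norm_add_le_of_le (norm_add_le_of_le t1 t2) t3) hpq).trans ?_
  -- The cubic terms sum to `36 * β ^ 2 * d ^ 3`; the only quartic one, `8 * β ^ 3 * d ^ 4`, costs 4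
  -- more.
  have h4 : 8 * (β ^ 2 * d ^ 3) * (β * d) ≤ 8 * (β ^ 2 * d ^ 3) * (1 / 2) := by gcongr
  nlinarith [h4]

theorem rank_P_le (h : LowRankPerturbation G₀ E D P Q B A) : P.rank ≤ B.rank := by
  rw [← h.G_mul_B]
  exact Matrix.rank_mul_le_right _ _

theorem rank_Q_le (h : LowRankPerturbation G₀ E D P Q B A) : Q.rank ≤ B.rank := by
  rw [← h.B_mul_G]
  exact Matrix.rank_mul_le_left _ _

theorem norm_quadTerm_le (h : LowRankPerturbation G₀ E D P Q B A) {β a b : ℝ} (hB : ‖B‖ ≤ β)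
    {V V' : Matrix m n ℝ} (ha : ‖V‖ ≤ a) (hb : ‖V'‖ ≤ b) :
    ‖quadTerm P Q B V V'‖ ≤ 3 * β * a * b := by
  have hBt : ‖Bᵀ‖ ≤ β := by rwa [norm_transpose]
  have hat : ‖Vᵀ‖ ≤ a := by rwa [norm_transpose]
  have hbt : ‖V'ᵀ‖ ≤ b := by rwa [norm_transpose]
  have hM := h.norm_one_sub_P_le
  have hN := h.norm_one_sub_Q_le
  refine (norm_add₃_le.trans (add_le_add (add_le_add
    (norm_mul_le_of_le (norm_mul_le_of_le (norm_mul_le_of_le (norm_mul_le_of_le hM ha) hB) hb) hN)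
    (norm_mul_le_of_le (norm_mul_le_of_le (norm_mul_le_of_le (norm_mul_le_of_le hBt hat) hM) hb)
      hN))
    (norm_mul_le_of_le (norm_mul_le_of_le (norm_mul_le_of_le (norm_mul_le_of_le hM ha) hN) hbt)
      hBt))).trans (le_of_eq (by ring))

theorem norm_quadTerm_sub_le (h : LowRankPerturbation G₀ E D P Q B A) {β d : ℝ} (hB : ‖B‖ ≤ β)
    {E₁ E₂ : Matrix m n ℝ} (h₁ : ‖E₁‖ ≤ d) (h₂ : ‖E₂‖ ≤ d) :
    ‖quadTerm P Q B E₁ E₁ - quadTerm P Q B E₂ E₂‖ ≤ 6 * β * d * ‖E₁ - E₂‖ := by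
  have : quadTerm P Q B E₁ E₁ - quadTerm P Q B E₂ E₂
      = quadTerm P Q B (E₁ - E₂) E₁ + quadTerm P Q B E₂ (E₁ - E₂) := by
    have e1 : quadTerm P Q B (E₁ - E₂) E₁ = quadTerm P Q B E₁ E₁ - quadTerm P Q B E₂ E₁ := by
      unfold quadTerm
      rw [Matrix.transpose_sub, Matrix.mul_sub (1 - P), Matrix.mul_sub Bᵀ]
      simp only [Matrix.sub_mul _ _ B, Matrix.sub_mul _ _ E₁, Matrix.sub_mul _ _ (1 - P),
        Matrix.sub_mul _ _ (1 - Q), Matrix.sub_mul _ _ E₁ᵀ, Matrix.sub_mul _ _ Bᵀ]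
      abel
    have e2 : quadTerm P Q B E₂ (E₁ - E₂) = quadTerm P Q B E₂ E₁ - quadTerm P Q B E₂ E₂ := by
      unfold quadTerm
      rw [Matrix.transpose_sub]
      simp only [Matrix.mul_sub _ E₁ E₂, Matrix.mul_sub _ E₁ᵀ E₂ᵀ, Matrix.sub_mul _ _ (1 - Q),
        Matrix.sub_mul _ _ Bᵀ]
      abel
    rw [e1, e2]; abel
  rw [this]
  refine (norm_add_le_of_le (h.norm_quadTerm_le hB le_rfl h₁)
    (h.norm_quadTerm_le hB h₂ le_rfl)).trans (le_of_eq (by ring))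

theorem rank_quadTerm_le {r : ℕ} (hr : B.rank ≤ r) (V V' : Matrix m n ℝ) :
    (quadTerm P Q B V V').rank ≤ 3 * r := by
  have h1 : ((1 - P) * V * B * V' * (1 - Q)).rank ≤ r :=
    (Matrix.rank_mul_le_left _ _).trans ((Matrix.rank_mul_le_left _ _).trans
      ((Matrix.rank_mul_le_right _ _).trans hr))
  have h2 : (Bᵀ * Vᵀ * (1 - P) * V' * (1 - Q)).rank ≤ r :=
    (Matrix.rank_mul_le_left _ _).trans ((Matrix.rank_mul_le_left _ _).trans
      ((Matrix.rank_mul_le_left _ _).trans ((Matrix.rank_mul_le_left _ _).trans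
        (B.rank_transpose.le.trans hr))))
  have h3 : ((1 - P) * V * (1 - Q) * V'ᵀ * Bᵀ).rank ≤ r :=
    (Matrix.rank_mul_le_right _ _).trans (B.rank_transpose.le.trans hr)
  exact (rank_add_le_of_le (rank_add_le_of_le h1 h2) h3).trans (by omega)

/-- The full-rank parts of `E` and `(1 - P) * E * (1 - Q)` cancel. The rest is `D`, `P * E`, `(1 -
P) * E * Q` and `quadTerm`, of ranks at most `2r`, `r`, `r` and `3r`. -/
theorem rank_remainder_le (h : LowRankPerturbation G₀ E D P Q B A) {r : ℕ} (hr : B.rank ≤ r)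
    (hD : D.rank ≤ 2 * r) :
    ((E + D) - ((1 - P) * E * (1 - Q) - quadTerm P Q B E E)).rank ≤ 7 * r := by
  have e : (E + D) - ((1 - P) * E * (1 - Q) - quadTerm P Q B E E)
      = D + P * E + (1 - P) * E * Q + quadTerm P Q B E E := by
    simp only [Matrix.mul_sub, Matrix.sub_mul, Matrix.mul_one, Matrix.one_mul]
    abel
  rw [e]
  exact (rank_add_le_of_le (rank_add_le_of_le (rank_add_le_of_le hD
    ((Matrix.rank_mul_le_left _ _).trans (h.rank_P_le.trans hr)))
    ((Matrix.rank_mul_le_right _ _).trans (h.rank_Q_le.trans hr)))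
    (rank_quadTerm_le hr E E)).trans (by omega)

end LowRankPerturbation
end Expansion
-- Factor projections, pseudoinverse and the perturbation data
section Factors

open scoped Matrix.Norms.L2Operator

variable {m n r : Type*} [Fintype m] [Fintype n] [Fintype r] [DecidableEq m] [DecidableEq n]
  [DecidableEq r]

/-- The orthogonal projection onto the column space of a matrix of full column rank. -/
noncomputable def colProj (A : Matrix m r ℝ) : Matrix m m ℝ := A * (Aᵀ * A)⁻¹ * Aᵀ

/-- The pseudoinverse of `lam * fᵀ` when `lam` and `f` have full column rank. -/
noncomputable def factorPinv (lam : Matrix m r ℝ) (f : Matrix n r ℝ) : Matrix n m ℝ :=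
  f * (fᵀ * f)⁻¹ * (lamᵀ * lam)⁻¹ * lamᵀ

theorem gram_inv_transpose (A : Matrix m r ℝ) : ((Aᵀ * A)⁻¹)ᵀ = (Aᵀ * A)⁻¹ := by
  rw [Matrix.transpose_nonsing_inv, Matrix.transpose_mul, Matrix.transpose_transpose]

theorem colProj_transpose (A : Matrix m r ℝ) : (colProj A)ᵀ = colProj A := by
  simp only [colProj, Matrix.transpose_mul, Matrix.transpose_transpose, gram_inv_transpose,
    Matrix.mul_assoc]

theorem factorPinv_transpose (lam : Matrix m r ℝ) (f : Matrix n r ℝ) :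
    (factorPinv lam f)ᵀ = lam * (lamᵀ * lam)⁻¹ * (fᵀ * f)⁻¹ * fᵀ := by
  simp only [factorPinv, Matrix.transpose_mul, Matrix.transpose_transpose, gram_inv_transpose,
    Matrix.mul_assoc]

theorem rank_factorPinv_le (lam : Matrix m r ℝ) (f : Matrix n r ℝ) :
    (factorPinv lam f).rank ≤ Fintype.card r := by
  refine (Matrix.rank_mul_le_left _ _).trans ?_
  exact Matrix.rank_le_card_width _

theorem colProj_mul {A : Matrix m r ℝ} (hA : IsUnit (Aᵀ * A).det) : colProj A * A = A := by
  rw [colProj, Matrix.mul_assoc, Matrix.mul_assoc, Matrix.nonsing_inv_mul _ hA, Matrix.mul_one]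

theorem transpose_mul_colProj {A : Matrix m r ℝ} (hA : IsUnit (Aᵀ * A).det) :
    Aᵀ * colProj A = Aᵀ := by
  rw [colProj, ← Matrix.mul_assoc, ← Matrix.mul_assoc, Matrix.mul_nonsing_inv _ hA, Matrix.one_mul]

theorem colProj_idem {A : Matrix m r ℝ} (hA : IsUnit (Aᵀ * A).det) :
    colProj A * colProj A = colProj A := by
  calc colProj A * colProj A = A * (Aᵀ * A)⁻¹ * (Aᵀ * colProj A) := Matrix.mul_assoc _ _ _
    _ = colProj A := by rw [transpose_mul_colProj hA]; rfl

theorem rank_colProj_le (A : Matrix m r ℝ) : (colProj A).rank ≤ Fintype.card r := by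
  refine (Matrix.rank_mul_le_left _ _).trans ?_
  exact Matrix.rank_le_card_width _

/-- The matrix `1 - factorPinv lam f * D` is invertible by the Neumann series. As `factorPinv`
starts with `f`, Sylvester's determinant identity moves this to an `r × r` matrix, which is the
overlap up to the two Gram factors. -/
theorem isUnit_det_overlap {lam L : Matrix m r ℝ} {f F : Matrix n r ℝ}
    (hl : IsUnit (lamᵀ * lam).det) (hf : IsUnit (fᵀ * f).det)
    (hsmall : ‖factorPinv lam f‖ * ‖lam * fᵀ - L * Fᵀ‖ ≤ 1 / 2) :
    IsUnit ((lamᵀ * L) * (Fᵀ * f)).det := by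
  set D := lam * fᵀ - L * Fᵀ with hD
  have h1 : IsUnit (1 - factorPinv lam f * D) :=
    isUnit_one_sub_of_norm_lt_one (((Matrix.l2_opNorm_mul _ _).trans hsmall).trans_lt (by norm_num))
  rw [Matrix.isUnit_iff_isUnit_det] at h1
  have h2 : factorPinv lam f * D = f * ((fᵀ * f)⁻¹ * (lamᵀ * lam)⁻¹ * lamᵀ * D) := by
    simp only [factorPinv, Matrix.mul_assoc]
  rw [h2, Matrix.det_one_sub_mul_comm] at h1
  have h3 : (lamᵀ * L) * (Fᵀ * f) = (lamᵀ * lam) * (fᵀ * f)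
      * (1 - (fᵀ * f)⁻¹ * (lamᵀ * lam)⁻¹ * lamᵀ * D * f) := by
    have : (lamᵀ * lam) * (fᵀ * f) * ((fᵀ * f)⁻¹ * (lamᵀ * lam)⁻¹ * lamᵀ * D * f)
        = lamᵀ * D * f := by
      calc (lamᵀ * lam) * (fᵀ * f) * ((fᵀ * f)⁻¹ * (lamᵀ * lam)⁻¹ * lamᵀ * D * f)
          = (lamᵀ * lam) * (((fᵀ * f) * (fᵀ * f)⁻¹) * ((lamᵀ * lam)⁻¹ * (lamᵀ * D * f))) := by
            simp only [Matrix.mul_assoc]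
        _ = lamᵀ * D * f := by
            rw [Matrix.mul_nonsing_inv _ hf, Matrix.one_mul, ← Matrix.mul_assoc,
              Matrix.mul_nonsing_inv _ hl, Matrix.one_mul]
    rw [Matrix.mul_sub, this, Matrix.mul_one, hD, Matrix.mul_sub, Matrix.sub_mul]
    simp only [Matrix.mul_assoc]
    abel
  rw [h3, Matrix.det_mul, Matrix.det_mul]
  exact (hl.mul hf).mul h1

/-- The generalized inverse of `L * Fᵀ` is `f * ((lamᵀ * L) * (Fᵀ * f))⁻¹ * lamᵀ`. Unlike the
Moore-Penrose inverse, it has its row and column spaces tied to the true factors, so that `Q * A =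
A` and `A * P = A`. -/
theorem exists_lowRankPerturbation {lam L : Matrix m r ℝ} {f F : Matrix n r ℝ}
    {E : Matrix m n ℝ} (hl : IsUnit (lamᵀ * lam).det) (hf : IsUnit (fᵀ * f).det)
    (hsmall : ‖factorPinv lam f‖ * ‖lam * fᵀ - L * Fᵀ‖ ≤ 1 / 2)
    (hL : Lᵀ * (E + (lam * fᵀ - L * Fᵀ)) = 0) (hF : (E + (lam * fᵀ - L * Fᵀ)) * F = 0) :
    ∃ A, LowRankPerturbation (lam * fᵀ) E (lam * fᵀ - L * Fᵀ) (colProj lam) (colProj f)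
      (factorPinv lam f) A := by
  have hS := isUnit_det_overlap hl hf hsmall
  have hX : IsUnit (lamᵀ * L).det := by
    rw [Matrix.det_mul] at hS; exact isUnit_of_mul_isUnit_left hS
  have hY : IsUnit (Fᵀ * f).det := by
    rw [Matrix.det_mul] at hS; exact isUnit_of_mul_isUnit_right hS
  have hG : lam * fᵀ - (lam * fᵀ - L * Fᵀ) = L * Fᵀ := by abel
  have hGB : lam * fᵀ * factorPinv lam f = colProj lam := by
    calc lam * fᵀ * factorPinv lam f
        = lam * (((fᵀ * f) * (fᵀ * f)⁻¹) * ((lamᵀ * lam)⁻¹ * lamᵀ)) := by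
          simp only [factorPinv, Matrix.mul_assoc]
      _ = _ := by
          rw [Matrix.mul_nonsing_inv _ hf, Matrix.one_mul, colProj, Matrix.mul_assoc]
  have hBG : factorPinv lam f * (lam * fᵀ) = colProj f := by
    calc factorPinv lam f * (lam * fᵀ)
        = f * (fᵀ * f)⁻¹ * (((lamᵀ * lam)⁻¹ * (lamᵀ * lam)) * fᵀ) := by
          simp only [factorPinv, Matrix.mul_assoc]
      _ = _ := by
          rw [Matrix.nonsing_inv_mul _ hl, Matrix.one_mul, colProj]
  have hAP : f * ((lamᵀ * L) * (Fᵀ * f))⁻¹ * lamᵀ * colProj lam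
      = f * ((lamᵀ * L) * (Fᵀ * f))⁻¹ * lamᵀ := by
    rw [Matrix.mul_assoc, transpose_mul_colProj hl]
  refine ⟨f * ((lamᵀ * L) * (Fᵀ * f))⁻¹ * lamᵀ, colProj_transpose _, colProj_idem hl,
    colProj_transpose _, colProj_idem hf, hGB, hBG, ?_, ?_, ?_, ?_, ?_, hAP, ?_, ?_, ?_, ?_⟩
  · simp only [factorPinv, ← Matrix.mul_assoc]
    rw [colProj_mul hf]
  · rw [factorPinv, Matrix.mul_assoc, transpose_mul_colProj hl]
  · rw [← Matrix.mul_assoc, colProj_mul hl]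
  · rw [Matrix.mul_assoc, transpose_mul_colProj hf]
  · simp only [← Matrix.mul_assoc]
    rw [colProj_mul hf]
  · rw [hG, Matrix.mul_inv_rev]
    calc L * Fᵀ * (f * ((Fᵀ * f)⁻¹ * (lamᵀ * L)⁻¹) * lamᵀ) * (L * Fᵀ)
        = L * (((Fᵀ * f) * (Fᵀ * f)⁻¹) * (((lamᵀ * L)⁻¹ * (lamᵀ * L)) * Fᵀ)) := by
          simp only [Matrix.mul_assoc]
      _ = L * Fᵀ := by
          rw [Matrix.mul_nonsing_inv _ hY, Matrix.nonsing_inv_mul _ hX, Matrix.one_mul,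
            Matrix.one_mul]
  -- Here `A * G₀ * B = A * P = A`, while `A * (L * Fᵀ) * B = B` because the overlap cancels its
  -- inverse.
  · rw [Matrix.mul_sub, Matrix.sub_mul, Matrix.mul_assoc _ (lam * fᵀ), hGB, hAP]
    congr 1
    calc factorPinv lam f
        = f * ((((lamᵀ * L) * (Fᵀ * f))⁻¹ * ((lamᵀ * L) * (Fᵀ * f)))
          * ((fᵀ * f)⁻¹ * (lamᵀ * lam)⁻¹ * lamᵀ)) := by
          rw [Matrix.nonsing_inv_mul _ hS, Matrix.one_mul]
          simp only [factorPinv, Matrix.mul_assoc]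
      _ = _ := by simp only [factorPinv, Matrix.mul_assoc]
  · rw [hG, Matrix.transpose_mul, Matrix.mul_assoc, hL, Matrix.mul_zero]
  · rw [hG, Matrix.transpose_mul, Matrix.transpose_transpose, ← Matrix.mul_assoc, hF,
      Matrix.zero_mul]

theorem norm_mul_gram_inv_sq {A : Matrix m r ℝ} (hA : IsUnit (Aᵀ * A).det) :
    ‖A * (Aᵀ * A)⁻¹‖ ^ 2 = ‖(Aᵀ * A)⁻¹‖ := by
  rw [sq, ← norm_transpose_mul_self, Matrix.transpose_mul, gram_inv_transpose, Matrix.mul_assoc,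
    ← Matrix.mul_assoc Aᵀ, Matrix.mul_nonsing_inv _ hA, Matrix.mul_one]

/-- The pseudoinverse is `f * (fᵀ * f)⁻¹` times the transpose of `lam * (lamᵀ * lam)⁻¹`, and the
squared norm of each factor is that of its inverse Gram matrix. -/
theorem norm_factorPinv_sq_le {lam : Matrix m r ℝ} {f : Matrix n r ℝ}
    (hl : IsUnit (lamᵀ * lam).det) (hf : IsUnit (fᵀ * f).det) :
    ‖factorPinv lam f‖ ^ 2 ≤ ‖(fᵀ * f)⁻¹‖ * ‖(lamᵀ * lam)⁻¹‖ := by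
  have h : factorPinv lam f = f * (fᵀ * f)⁻¹ * (lam * (lamᵀ * lam)⁻¹)ᵀ := by
    rw [Matrix.transpose_mul, gram_inv_transpose, factorPinv]
    simp only [Matrix.mul_assoc]
  rw [← norm_mul_gram_inv_sq hf, ← norm_mul_gram_inv_sq hl, ← mul_pow, h]
  refine pow_le_pow_left₀ (norm_nonneg _) ?_ 2
  exact norm_mul_le_of_le le_rfl (norm_transpose _).le

/-- A matrix within `1 / (2 ‖S⁻¹‖)` of an invertible matrix `S` is invertible. -/
theorem isUnit_det_and_norm_inv_le {S A : Matrix r r ℝ} (hS : IsUnit S.det)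
    (h : ‖S⁻¹‖ * ‖A - S‖ ≤ 1 / 2) : IsUnit A.det ∧ ‖A⁻¹‖ ≤ 2 * ‖S⁻¹‖ := by
  have h1 : IsUnit (1 - S⁻¹ * (S - A)) := by
    refine isUnit_one_sub_of_norm_lt_one (((Matrix.l2_opNorm_mul _ _).trans ?_).trans_lt
      (by norm_num : (1 / 2 : ℝ) < 1))
    rwa [norm_sub_rev]
  have h2 : A = S * (1 - S⁻¹ * (S - A)) := by
    rw [Matrix.mul_sub, ← Matrix.mul_assoc, Matrix.mul_nonsing_inv _ hS]
    simp
  have hA : IsUnit A.det := by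
    rw [h2, Matrix.det_mul]
    exact hS.mul ((Matrix.isUnit_iff_isUnit_det _).1 h1)
  refine ⟨hA, ?_⟩
  have h3 : A⁻¹ = S⁻¹ - S⁻¹ * (A - S) * A⁻¹ := by
    rw [Matrix.mul_sub, Matrix.sub_mul, Matrix.nonsing_inv_mul _ hS, Matrix.mul_assoc,
      Matrix.mul_nonsing_inv _ hA]
    simp
  have h4 : ‖A⁻¹‖ ≤ ‖S⁻¹‖ + ‖S⁻¹‖ * ‖A - S‖ * ‖A⁻¹‖ := by
    conv_lhs => rw [h3]
    exact norm_sub_le_of_le le_rfl (norm_mul_le_of_le (Matrix.l2_opNorm_mul _ _) le_rfl)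
  nlinarith [mul_le_mul_of_nonneg_right h (norm_nonneg A⁻¹)]

end Factors

/-! ### First-order conditions -/

section LeastSquares

open scoped Matrix.Norms.L2Operator

variable {N T R K : ℕ}

theorem hsNormSq_eq (A : Matrix (Fin N) (Fin T) ℝ) : hsNormSq A = (Aᵀ * A).trace :=
  Matrix.trace_mul_comm _ _

theorem hsNormSq_nonneg (A : Matrix (Fin N) (Fin T) ℝ) : 0 ≤ hsNormSq A := by
  rw [hsNormSq_eq]; exact trace_transpose_mul_self_nonneg A

theorem trace_transpose_mul_comm (A B : Matrix (Fin N) (Fin T) ℝ) :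
    (Aᵀ * B).trace = (Bᵀ * A).trace := by
  rw [← Matrix.trace_transpose, Matrix.transpose_mul, Matrix.transpose_transpose]

theorem hsNormSq_add (A B : Matrix (Fin N) (Fin T) ℝ) :
    hsNormSq (A + B) = hsNormSq A + 2 * (Aᵀ * B).trace + hsNormSq B := by
  simp only [hsNormSq_eq, Matrix.transpose_add, Matrix.add_mul, Matrix.mul_add, Matrix.trace_add]
  rw [trace_transpose_mul_comm B A]
  ring

theorem hsNormSq_smul (t : ℝ) (A : Matrix (Fin N) (Fin T) ℝ) :
    hsNormSq (t • A) = t ^ 2 * hsNormSq A := by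
  simp only [hsNormSq_eq, Matrix.transpose_smul, Matrix.smul_mul, Matrix.mul_smul,
    Matrix.trace_smul, smul_eq_mul]
  ring

theorem eq_zero_of_hsNormSq {A : Matrix (Fin N) (Fin T) ℝ} (h : hsNormSq A = 0) : A = 0 := by
  have h1 := norm_sq_le_trace A
  rw [← hsNormSq_eq, h] at h1
  exact norm_eq_zero.1 (by nlinarith [norm_nonneg A])

theorem trace_eq_zero_of_minimal {U V : Matrix (Fin N) (Fin T) ℝ}
    (h : ∀ t : ℝ, hsNormSq U ≤ hsNormSq (U + t • V)) : (Uᵀ * V).trace = 0 := by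
  set a := (Uᵀ * V).trace with ha
  set v := hsNormSq V with hv
  have hv0 : 0 ≤ v := hsNormSq_nonneg V
  -- Near-optimal step length; `v + 1` in place of `v` avoids a division by zero when `V = 0`.
  have h1 := h (-(a / (v + 1)))
  rw [hsNormSq_add, hsNormSq_smul, Matrix.mul_smul, Matrix.trace_smul, ← ha, ← hv,
    smul_eq_mul] at h1
  have h2 : 2 * (-(a / (v + 1)) * a) + (-(a / (v + 1))) ^ 2 * v
      = -(a / (v + 1)) ^ 2 * (v + 2) := by field_simp; ring
  have h3 : (a / (v + 1)) ^ 2 * (v + 2) ≤ 0 := by linarith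
  have h4 : (a / (v + 1)) ^ 2 = 0 := by nlinarith [sq_nonneg (a / (v + 1))]
  have h5 : a / (v + 1) = 0 := by simpa using h4
  rcases div_eq_zero_iff.1 h5 with h6 | h6
  · exact h6
  · linarith

theorem linComb_add_smul_single (β : Fin K → ℝ) (X : Fin K → Matrix (Fin N) (Fin T) ℝ)
    (t : ℝ) (k : Fin K) : linComb (β + t • Pi.single k 1) X = linComb β X + t • X k := by
  simp only [linComb, Pi.add_apply, Pi.smul_apply, add_smul, Finset.sum_add_distrib, smul_eq_mul]
  congr 1
  rw [Finset.sum_eq_single k] <;> simp +contextual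

/-- The first-order conditions for a least squares estimate. -/
theorem first_order_conditions {Y : Matrix (Fin N) (Fin T) ℝ}
    {X : Fin K → Matrix (Fin N) (Fin T) ℝ} {β : Fin K → ℝ}
    {L : Matrix (Fin N) (Fin R) ℝ} {F : Matrix (Fin T) (Fin R) ℝ}
    (h : ∀ (β' : Fin K → ℝ) (L' : Matrix (Fin N) (Fin R) ℝ) (F' : Matrix (Fin T) (Fin R) ℝ),
      hsNormSq (Y - linComb β X - L * Fᵀ) ≤ hsNormSq (Y - linComb β' X - L' * F'ᵀ)) :
    Lᵀ * (Y - linComb β X - L * Fᵀ) = 0 ∧ (Y - linComb β X - L * Fᵀ) * F = 0 ∧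
      ∀ k, ((X k)ᵀ * (Y - linComb β X - L * Fᵀ)).trace = 0 := by
  set U := Y - linComb β X - L * Fᵀ with hU
  refine ⟨?_, ?_, fun k => ?_⟩
  -- Moving `F` along `Uᵀ * L` makes the directional derivative a multiple of the squared norm of
  -- `Lᵀ * U`; moving `L` along `U * F` does the same below.
  · have h1 : (Uᵀ * (L * (Lᵀ * U))).trace = 0 := trace_eq_zero_of_minimal fun t => by
      convert h β L (F - t • (Uᵀ * L)) using 2
      rw [hU]
      simp only [Matrix.transpose_sub, Matrix.transpose_smul, Matrix.transpose_mul,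
        Matrix.transpose_transpose, Matrix.mul_sub, Matrix.mul_smul, smul_sub]
      abel
    refine eq_zero_of_hsNormSq ?_
    rw [hsNormSq_eq, Matrix.transpose_mul, Matrix.transpose_transpose, Matrix.mul_assoc, h1]
  · have h1 : (Uᵀ * ((U * F) * Fᵀ)).trace = 0 := trace_eq_zero_of_minimal fun t => by
      convert h β (L - t • (U * F)) F using 2
      rw [hU]
      simp only [Matrix.sub_mul, Matrix.smul_mul, smul_sub]
      abel
    refine eq_zero_of_hsNormSq ?_
    rw [hsNormSq_eq, Matrix.transpose_mul, Matrix.mul_assoc, Matrix.trace_mul_comm,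
      Matrix.mul_assoc, h1]
  · have h1 : (Uᵀ * X k).trace = 0 := trace_eq_zero_of_minimal fun t => by
      convert h (β + (-t) • Pi.single k 1) L F using 2
      rw [hU, linComb_add_smul_single]
      simp only [neg_smul]
      abel
    rw [trace_transpose_mul_comm, h1]

/-- A low-rank correction that decreases the Hilbert-Schmidt norm of `E` is of the order of the
spectral norm of `E`. -/
theorem norm_le_of_hsNormSq_add_le {E D : Matrix (Fin N) (Fin T) ℝ} {q : ℕ} (hD : D.rank ≤ q)
    (h : hsNormSq (E + D) ≤ hsNormSq E) : ‖D‖ ≤ 4 * q * ‖E‖ := by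
  rw [hsNormSq_add] at h
  have h1 := abs_trace_transpose_mul_le E D hD
  have h2 := norm_sq_le_trace D
  rw [← hsNormSq_eq] at h2
  have h3 := neg_abs_le (Eᵀ * D).trace
  have h4 : ‖D‖ * ‖D‖ ≤ ‖D‖ * (4 * q * ‖E‖) := by nlinarith
  rcases (norm_nonneg D).eq_or_lt with h0 | h0
  · rw [← h0]; positivity
  · exact le_of_mul_le_mul_left h4 h0

end LeastSquares

/-! ### Annihilators under full column rank -/

section Annih

theorem gramPinv_eq_inv {m n : ℕ} {A : Matrix (Fin m) (Fin n) ℝ} (hA : IsUnit (Aᵀ * A).det) :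
    gramPinv A = (Aᵀ * A)⁻¹ := by
  have hu : IsUnit (Aᵀ * A) := (Matrix.isUnit_iff_isUnit_det _).2 hA
  have hsa : IsSelfAdjoint (Aᵀ * A) := by
    rw [IsSelfAdjoint, Matrix.star_eq_conjTranspose, Matrix.conjTranspose_eq_transpose_of_trivial,
      Matrix.transpose_mul, Matrix.transpose_transpose]
  obtain ⟨u, hu'⟩ := hu
  rw [gramPinv, ← hu', cfc_inv_id u (by rwa [hu']), Matrix.coe_units_inv]

theorem annih_eq {m n : ℕ} {A : Matrix (Fin m) (Fin n) ℝ} (hA : IsUnit (Aᵀ * A).det) :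
    annih A = 1 - colProj A := by
  rw [annih, gramPinv_eq_inv hA, colProj]

end Annih

/-! ### Tail eigenvalues and low-rank perturbations -/

section Tail

open scoped Matrix.Norms.L2Operator

/-- A weighted sum of a decreasing sequence with weights in `[0, 1]` of total mass at least
`M - q` is at least the sum over the indices from `q` on, if the sequence is nonnegative. -/
theorem sum_tail_le_weighted {M q : ℕ} {v w : Fin M → ℝ} (hv : Antitone v) (hv0 : ∀ i, 0 ≤ v i)
    (hw0 : ∀ i, 0 ≤ w i) (hw1 : ∀ i, w i ≤ 1) (hw : (M : ℝ) - q ≤ ∑ i, w i) :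
    ∑ i with q ≤ i.val, v i ≤ ∑ i, v i * w i := by
  rcases le_or_gt M q with hq | hq
  · rw [Finset.filter_false_of_mem fun i _ => by omega, Finset.sum_empty]
    exact Finset.sum_nonneg fun i _ => mul_nonneg (hv0 i) (hw0 i)
  · set c := v ⟨q, hq⟩ with hc
    have hcard : ∑ i : Fin M, (if q ≤ i.val then (1 : ℝ) else 0) = M - q := by
      have h := Fin.sum_univ_eq_sum_range (fun i => if q ≤ i then (1 : ℝ) else 0) M
      rw [h, ← Finset.sum_filter, Finset.sum_const]
      have : (Finset.range M).filter (fun i => q ≤ i) = Finset.Ico q M := by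
        ext i; simp; omega
      rw [this, Nat.card_Ico, nsmul_eq_mul, mul_one, Nat.cast_sub hq.le]
    -- With threshold `c = v q`, the factors `v i - c` and `w i - 1_{q ≤ i}` never have opposite
    -- signs.
    have hterm : ∀ i : Fin M, c * (w i - if q ≤ i.val then (1 : ℝ) else 0)
        ≤ v i * w i - if q ≤ i.val then v i else 0 := by
      intro i
      split_ifs with hi
      · have : v i ≤ c := hv (Fin.mk_le_of_le_val hi)
        nlinarith [hw1 i]
      · have : c ≤ v i := hv (by rw [Fin.le_def]; simp; omega)
        nlinarith [hw0 i]
    have hsum := Finset.sum_le_sum fun i (_ : i ∈ Finset.univ) => hterm i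
    rw [← Finset.mul_sum, Finset.sum_sub_distrib, Finset.sum_sub_distrib, hcard] at hsum
    rw [Finset.sum_filter]
    have : 0 ≤ c * (∑ i, w i - (M - q)) := mul_nonneg (hv0 _) (by linarith)
    linarith

/-- The spectral decomposition of a real symmetric matrix. -/
theorem exists_spectral_decomposition {n : Type*} [Fintype n] [DecidableEq n] {S : Matrix n n ℝ}
    (hS : S.IsHermitian) : ∃ U : Matrix n n ℝ, Uᵀ * U = 1 ∧ U * Uᵀ = 1 ∧
      S = U * Matrix.diagonal hS.eigenvalues * Uᵀ := by
  have h1 := Matrix.mem_unitaryGroup_iff.1 hS.eigenvectorUnitary.2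
  have h2 := hS.spectral_theorem
  rw [Unitary.conjStarAlgAut_apply] at h2
  rw [Matrix.star_eq_conjTranspose, Matrix.conjTranspose_eq_transpose_of_trivial] at h1 h2
  exact ⟨hS.eigenvectorUnitary, mul_eq_one_comm.1 h1, h1, h2⟩

/-- The orthogonal projection onto the kernel of a matrix. -/
theorem exists_kernel_projection {m n : Type*} [Fintype m] [Fintype n] [DecidableEq m]
    [DecidableEq n] (B : Matrix m n ℝ) :
    ∃ Q : Matrix n n ℝ, Qᵀ = Q ∧ Q * Q = Q ∧ B * Q = 0 ∧
      Q.trace = Fintype.card n - B.rank := by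
  classical
  have hH : (Bᵀ * B).IsHermitian := by
    simp [Matrix.IsHermitian, Matrix.conjTranspose_eq_transpose_of_trivial]
  obtain ⟨U, hUU, -, hspec⟩ := exists_spectral_decomposition hH
  set χ : n → ℝ := fun i => if hH.eigenvalues i = 0 then 1 else 0 with hχ
  refine ⟨U * Matrix.diagonal χ * Uᵀ, ?_, ?_, ?_, ?_⟩
  · simp [Matrix.transpose_mul, Matrix.mul_assoc]
  · calc U * Matrix.diagonal χ * Uᵀ * (U * Matrix.diagonal χ * Uᵀ)
        = U * (Matrix.diagonal χ * ((Uᵀ * U) * Matrix.diagonal χ)) * Uᵀ := by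
          simp only [Matrix.mul_assoc]
      _ = _ := by
          rw [hUU, Matrix.one_mul, Matrix.diagonal_mul_diagonal]
          congr 3; ext i; simp [hχ]
  · have h0 : Bᵀ * B * (U * Matrix.diagonal χ * Uᵀ) = 0 := by
      refine (congrArg (· * (U * Matrix.diagonal χ * Uᵀ)) hspec).trans ?_
      calc U * Matrix.diagonal hH.eigenvalues * Uᵀ * (U * Matrix.diagonal χ * Uᵀ)
          = U * (Matrix.diagonal hH.eigenvalues * ((Uᵀ * U) * Matrix.diagonal χ)) * Uᵀ := by
            simp only [Matrix.mul_assoc]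
        _ = 0 := by
            rw [hUU, Matrix.one_mul, Matrix.diagonal_mul_diagonal]
            have : (fun i => hH.eigenvalues i * χ i) = 0 := by
              ext i; simp [hχ]
            rw [this]
            simp
    have h1 : ‖B * (U * Matrix.diagonal χ * Uᵀ)‖ * ‖B * (U * Matrix.diagonal χ * Uᵀ)‖ = 0 := by
      rw [← norm_transpose_mul_self, Matrix.transpose_mul, Matrix.mul_assoc, ← Matrix.mul_assoc Bᵀ,
        h0, Matrix.mul_zero, norm_zero]
    exact norm_eq_zero.1 (mul_self_eq_zero.1 h1)
  · rw [Matrix.trace_mul_comm, ← Matrix.mul_assoc, hUU, Matrix.one_mul, Matrix.trace_diagonal]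
    have h1 : B.rank = Fintype.card {i // hH.eigenvalues i ≠ 0} := by
      rw [← hH.rank_eq_card_non_zero_eigs, Matrix.rank_transpose_mul_self]
    have h2 := Fintype.card_subtype_compl (fun i => hH.eigenvalues i = 0)
    have h3 := Fintype.card_subtype_le (fun i => hH.eigenvalues i = 0)
    rw [h1]
    simp only [hχ, Finset.sum_ite, Finset.sum_const_zero, add_zero, Finset.sum_const, nsmul_eq_mul,
      mul_one]
    rw [← Fintype.card_subtype, h2, Nat.cast_sub h3]
    ring

/-- The weights are the diagonal entries of the projection `Q` in an eigenbasis of `S`. A diagonal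
entry of a projection is the sum of squares of its row, hence it lies in `[0, 1]`. -/
theorem trace_mul_eq_sum_eigenvalues₀ {n : ℕ} {S Q : Matrix (Fin n) (Fin n) ℝ}
    (hS : S.IsHermitian) (hs : Qᵀ = Q) (hi : Q * Q = Q) :
    ∃ w : Fin (Fintype.card (Fin n)) → ℝ, (∀ i, 0 ≤ w i) ∧ (∀ i, w i ≤ 1) ∧
      ∑ i, w i = Q.trace ∧ (S * Q).trace = ∑ i, hS.eigenvalues₀ i * w i := by
  obtain ⟨U, -, hUU, hspec⟩ := exists_spectral_decomposition hS
  set V : Matrix (Fin n) (Fin n) ℝ := Uᵀ * Q * U with hV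
  have hVs : Vᵀ = V := by simp [hV, Matrix.transpose_mul, hs, Matrix.mul_assoc]
  have hVi : V * V = V := by
    calc V * V = Uᵀ * (Q * ((U * Uᵀ) * Q)) * U := by simp only [hV, Matrix.mul_assoc]
      _ = V := by rw [hUU, Matrix.one_mul, hi]
  have hdiag : ∀ i, V i i = ∑ j, V i j ^ 2 := by
    intro i
    have h1 := congrFun (congrFun hVi i) i
    rw [Matrix.mul_apply] at h1
    rw [← h1]
    refine Finset.sum_congr rfl fun j _ => ?_
    have h2 : V j i = V i j := congrFun (congrFun hVs i) j
    rw [h2, sq]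
  have h0 : ∀ i, 0 ≤ V i i := fun i => by rw [hdiag]; positivity
  have h1 : ∀ i, V i i ≤ 1 := fun i => by
    have : V i i ^ 2 ≤ V i i := by
      conv_rhs => rw [hdiag]
      exact Finset.single_le_sum (f := fun j => V i j ^ 2) (fun j _ => sq_nonneg _)
        (Finset.mem_univ i)
    nlinarith [h0 i]
  let φ : Fin (Fintype.card (Fin n)) ≃ Fin n :=
    Fintype.equivOfCardEq (Fintype.card_fin (Fintype.card (Fin n)))
  have hφ : ∀ i, hS.eigenvalues (φ i) = hS.eigenvalues₀ i := fun i => by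
    simp [Matrix.IsHermitian.eigenvalues, φ]
  refine ⟨fun i => V (φ i) (φ i), fun i => h0 _, fun i => h1 _, ?_, ?_⟩
  · rw [φ.sum_comp fun i => V i i]
    change V.trace = _
    rw [hV, Matrix.trace_mul_comm, ← Matrix.mul_assoc, hUU, Matrix.one_mul]
  · have h2 : (S * Q).trace = (Matrix.diagonal hS.eigenvalues * V).trace := by
      refine (congrArg (fun M => (M * Q).trace) hspec).trans ?_
      rw [hV, Matrix.mul_assoc, Matrix.mul_assoc, Matrix.trace_mul_comm]
      simp only [Matrix.mul_assoc]
    rw [h2, Matrix.trace]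
    simp only [Matrix.diag_apply, Matrix.diagonal_mul]
    rw [← φ.sum_comp]
    simp only [hφ]

theorem eigenvalues₀_nonneg_of_posSemidef {n : ℕ} {S : Matrix (Fin n) (Fin n) ℝ}
    (hS : S.IsHermitian) (hp : S.PosSemidef) (i : Fin (Fintype.card (Fin n))) :
    0 ≤ hS.eigenvalues₀ i := by
  have h := hp.eigenvalues_nonneg (Fintype.equivOfCardEq (Fintype.card_fin _) i)
  simpa [Matrix.IsHermitian.eigenvalues] using h

theorem hsNormSq_mul_le {N T : ℕ} (A : Matrix (Fin N) (Fin T) ℝ) {Q : Matrix (Fin T) (Fin T) ℝ}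
    (hs : Qᵀ = Q) (hi : Q * Q = Q) : hsNormSq (A * Q) ≤ hsNormSq A := by
  have h : hsNormSq A = hsNormSq (A * Q) + hsNormSq (A * (1 - Q)) := by
    have h1 : (1 - Q) * Q = 0 := by rw [Matrix.sub_mul, hi, Matrix.one_mul, sub_self]
    have h2 : ((A * Q)ᵀ * (A * (1 - Q))).trace = 0 := by
      rw [Matrix.trace_mul_comm, Matrix.transpose_mul, hs, Matrix.mul_assoc,
        ← Matrix.mul_assoc _ Q, h1, Matrix.zero_mul, Matrix.mul_zero, Matrix.trace_zero]
    have h3 := hsNormSq_add (A * Q) (A * (1 - Q))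
    rw [← Matrix.mul_add, add_sub_cancel, Matrix.mul_one, h2] at h3
    linarith
  have := hsNormSq_nonneg (A * (1 - Q))
  linarith

/-- A perturbation of rank at most `q` leaves at least the tail of the spectrum. -/
theorem tailEig_le_hsNormSq_add {N T : ℕ} (A B : Matrix (Fin N) (Fin T) ℝ) {q : ℕ}
    (hB : B.rank ≤ q) (hNT : 0 < (N : ℝ) * T) :
    (N : ℝ) * T * tailEig q A ≤ hsNormSq (A + B) := by
  obtain ⟨Q, hs, hi, hBQ, htr⟩ := exists_kernel_projection B
  obtain ⟨w, hw0, hw1, hwQ, hsum⟩ := trace_mul_eq_sum_eigenvalues₀ (normGram_isHermitian A) hs hi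
  have hps : (normGram A).PosSemidef := by
    rw [normGram, ← Matrix.conjTranspose_eq_transpose_of_trivial]
    exact (Matrix.posSemidef_conjTranspose_mul_self A).smul (by positivity)
  -- With `Q` the projection on the kernel of `B`, the weights sum to `T - rank B ≥ T - q`.
  have h1 : tailEig q A ≤ (normGram A * Q).trace := by
    rw [hsum]
    refine sum_tail_le_weighted ((normGram_isHermitian A).eigenvalues₀_antitone)
      (eigenvalues₀_nonneg_of_posSemidef _ hps) hw0 hw1 ?_
    rw [hwQ, htr]
    have : (B.rank : ℝ) ≤ q := by exact_mod_cast hB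
    linarith
  have h2 : (N : ℝ) * T * (normGram A * Q).trace = hsNormSq (A * Q) := by
    rw [normGram, Matrix.smul_mul, Matrix.trace_smul, smul_eq_mul, ← mul_assoc,
      mul_one_div_cancel hNT.ne', one_mul, hsNormSq, Matrix.transpose_mul, hs, Matrix.mul_assoc A,
      ← Matrix.mul_assoc Q, hi, Matrix.mul_assoc, Matrix.trace_mul_comm, Matrix.mul_assoc,
      Matrix.trace_mul_comm A]
  have h3 : (A + B) * Q = A * Q := by rw [Matrix.add_mul, hBQ, add_zero]
  calc (N : ℝ) * T * tailEig q A ≤ (N : ℝ) * T * (normGram A * Q).trace := by gcongr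
    _ = hsNormSq ((A + B) * Q) := by rw [h2, h3]
    _ ≤ _ := hsNormSq_mul_le _ hs hi

end Tail

/-! ### Existence of a least squares estimate -/

section Existence

open scoped Matrix.Norms.L2Operator

variable {N T K : ℕ}

theorem vecNorm_nonneg (v : Fin K → ℝ) : 0 ≤ vecNorm v := norm_nonneg _

theorem vecNorm_smul (c : ℝ) (v : Fin K → ℝ) : vecNorm (c • v) = |c| * vecNorm v := by
  rw [vecNorm, WithLp.toLp_smul, norm_smul, Real.norm_eq_abs, vecNorm]

theorem vecNorm_add_le (v w : Fin K → ℝ) : vecNorm (v + w) ≤ vecNorm v + vecNorm w := by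
  rw [vecNorm, WithLp.toLp_add]; exact norm_add_le _ _

theorem vecNorm_eq_zero {v : Fin K → ℝ} (h : vecNorm v = 0) : v = 0 := by
  have := norm_eq_zero.1 h
  simpa using this

theorem vecNorm_sq (v : Fin K → ℝ) : vecNorm v ^ 2 = ∑ i, v i ^ 2 := by
  rw [vecNorm, EuclideanSpace.norm_sq_eq]; simp

theorem abs_le_vecNorm (v : Fin K → ℝ) (i : Fin K) : |v i| ≤ vecNorm v := by
  refine abs_le_of_sq_le_sq ?_ (vecNorm_nonneg v)
  rw [vecNorm_sq]
  exact Finset.single_le_sum (f := fun i => v i ^ 2) (fun j _ => sq_nonneg _) (Finset.mem_univ i)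

theorem vecNorm_le_of_forall_abs_le {v : Fin K → ℝ} {c : ℝ} (h : ∀ i, |v i| ≤ c) :
    vecNorm v ≤ K * c := by
  have h1 : vecNorm v ≤ ∑ i, |v i| := by
    refine abs_le_of_sq_le_sq' ?_ (Finset.sum_nonneg fun i _ => abs_nonneg _) |>.2
    rw [vecNorm_sq]
    have := Finset.sum_sq_le_sq_sum_of_nonneg (s := Finset.univ) (f := fun i => |v i|)
      (fun i _ => abs_nonneg _)
    simpa using this
  refine h1.trans ((Finset.sum_le_card_nsmul _ _ c fun i _ => h i).trans ?_)
  simp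

theorem linComb_smul (c : ℝ) (β : Fin K → ℝ) (X : Fin K → Matrix (Fin N) (Fin T) ℝ) :
    linComb (c • β) X = c • linComb β X := by
  simp [linComb, Finset.smul_sum, smul_smul]

theorem linComb_sub (β β' : Fin K → ℝ) (X : Fin K → Matrix (Fin N) (Fin T) ℝ) :
    linComb (β - β') X = linComb β X - linComb β' X := by
  simp [linComb, sub_smul, Finset.sum_sub_distrib]

theorem norm_linComb_le {β : Fin K → ℝ} {X : Fin K → Matrix (Fin N) (Fin T) ℝ} {x : ℝ}
    (hX : ∀ k, ‖X k‖ ≤ x) : ‖linComb β X‖ ≤ K * x * vecNorm β := by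
  have h : ∀ k ∈ Finset.univ, ‖β k • X k‖ ≤ vecNorm β * x := fun k _ => by
    rw [norm_smul]
    exact mul_le_mul (abs_le_vecNorm β k) (hX k) (norm_nonneg _) (vecNorm_nonneg β)
  refine (norm_sum_le_of_le _ h).trans (le_of_eq ?_)
  rw [Finset.sum_const, Finset.card_univ, Fintype.card_fin, nsmul_eq_mul]; ring

/-- Noncollinearity bounds the regression part away from the low-rank matrices. -/
theorem le_hsNormSq_linComb_add {X : Fin K → Matrix (Fin N) (Fin T) ℝ} {q : ℕ} {b : ℝ}
    (hNT : 0 < (N : ℝ) * T) (hb : ∀ α : Fin K → ℝ, vecNorm α = 1 → b ≤ tailEig q (linComb α X))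
    (β : Fin K → ℝ) {B : Matrix (Fin N) (Fin T) ℝ} (hB : B.rank ≤ q) :
    (N : ℝ) * T * b * vecNorm β ^ 2 ≤ hsNormSq (linComb β X + B) := by
  rcases (vecNorm_nonneg β).eq_or_lt with h0 | h0
  · rw [← h0]
    simpa using hsNormSq_nonneg _
  · set c := vecNorm β with hc
    have h1 : vecNorm (c⁻¹ • β) = 1 := by
      rw [vecNorm_smul, abs_of_pos (inv_pos.2 h0), ← hc, inv_mul_cancel₀ h0.ne']
    have h2 : (c⁻¹ • B).rank ≤ q := by
      have : c⁻¹ • B = B * (c⁻¹ • (1 : Matrix (Fin T) (Fin T) ℝ)) := by simp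
      rw [this]
      exact (Matrix.rank_mul_le_left _ _).trans hB
    have h3 := tailEig_le_hsNormSq_add (linComb (c⁻¹ • β) X) (c⁻¹ • B) h2 hNT
    rw [linComb_smul, ← smul_add, hsNormSq_smul] at h3
    have h4 := hb _ h1
    rw [linComb_smul] at h4
    have h5 : (N : ℝ) * T * b ≤ c⁻¹ ^ 2 * hsNormSq (linComb β X + B) :=
      (mul_le_mul_of_nonneg_left h4 hNT.le).trans h3
    calc (N : ℝ) * T * b * c ^ 2 ≤ c⁻¹ ^ 2 * hsNormSq (linComb β X + B) * c ^ 2 := by gcongr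
      _ = _ := by field_simp

theorem exists_factorization {R : ℕ} {G : Matrix (Fin N) (Fin T) ℝ} (h : G.rank ≤ R) :
    ∃ (L : Matrix (Fin N) (Fin R) ℝ) (F : Matrix (Fin T) (Fin R) ℝ), G = L * Fᵀ := by
  let V := LinearMap.range G.mulVecLin
  have hV : Module.finrank ℝ V ≤ Module.finrank ℝ (Fin R → ℝ) := by
    simpa [V, Matrix.rank] using h
  obtain ⟨ι, hι⟩ := finrank_le_iff_exists_linearMap.1 hV
  obtain ⟨π, hπ⟩ := ι.exists_leftInverse_of_injective (LinearMap.ker_eq_bot.2 hι)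
  refine ⟨LinearMap.toMatrix' (V.subtype ∘ₗ π),
    (LinearMap.toMatrix' (ι ∘ₗ G.mulVecLin.rangeRestrict))ᵀ, ?_⟩
  rw [Matrix.transpose_transpose, ← LinearMap.toMatrix'_comp]
  have : (V.subtype ∘ₗ π) ∘ₗ ι ∘ₗ G.mulVecLin.rangeRestrict = G.mulVecLin := by
    ext1
    ext1
    have := fun x => LinearMap.congr_fun hπ x
    simp at this ⊢
    simp [this]
  rw [this]
  simp [← Matrix.toLin'_apply']

theorem rank_mul_transpose_le {R : ℕ} (L : Matrix (Fin N) (Fin R) ℝ)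
    (F : Matrix (Fin T) (Fin R) ℝ) : (L * Fᵀ).rank ≤ R :=
  (Matrix.rank_mul_le_left _ _).trans (by simpa using Matrix.rank_le_card_width L)

/-- Rank is lower semicontinuous: having rank at least `R + 1` is an open condition. -/
theorem isClosed_rank_le (R : ℕ) : IsClosed {G : Matrix (Fin N) (Fin T) ℝ | G.rank ≤ R} := by
  let φ : Matrix (Fin N) (Fin T) ℝ →ₗ[ℝ] ((Fin T → ℝ) →L[ℝ] (Fin N → ℝ)) :=
    (LinearMap.toContinuousLinearMap.toLinearMap) ∘ₗ (Matrix.toLin').toLinearMap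
  have hφ : Continuous φ := φ.continuous_of_finiteDimensional
  have ho := (isOpen_setOfPred_nat_le_rank (𝕜 := ℝ) (E := Fin T → ℝ) (F := Fin N → ℝ)
    (R + 1)).preimage hφ
  convert ho.isClosed_compl using 1
  ext G
  have h1 : ((φ G : (Fin T → ℝ) →L[ℝ] (Fin N → ℝ)) : (Fin T → ℝ) →ₗ[ℝ] (Fin N → ℝ))
      = G.mulVecLin := rfl
  simp only [Set.mem_ofPred_eq, Set.mem_compl_iff, Set.mem_preimage, h1]
  rw [LinearMap.rank, ← Module.finrank_eq_rank, Nat.cast_le]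
  change _ ↔ ¬ (R + 1 ≤ G.rank)
  omega

/-- The pair `(L, F)` ranges over an unbounded set even at a fixed product, so the minimum is taken
over `(β, G)` with `G` of rank at most `R`. That set is closed, and noncollinearity makes its
sublevel set bounded. -/
theorem exists_isLSEstimate {R q : ℕ} (hq : R ≤ q) {X : Fin K → Matrix (Fin N) (Fin T) ℝ} {b : ℝ}
    (hb0 : 0 < b) (hNT : 0 < (N : ℝ) * T)
    (hb : ∀ α : Fin K → ℝ, vecNorm α = 1 → b ≤ tailEig q (linComb α X))
    (Y : Matrix (Fin N) (Fin T) ℝ) : ∃ β, IsLSEstimate R Y X β := by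
  let g : (Fin K → ℝ) × Matrix (Fin N) (Fin T) ℝ → ℝ :=
    fun p => hsNormSq (Y - linComb p.1 X - p.2)
  have hg : Continuous g := by
    simp only [g, hsNormSq, linComb]
    fun_prop
  let S : Set ((Fin K → ℝ) × Matrix (Fin N) (Fin T) ℝ) := {p | p.2.rank ≤ R} ∩ {p | g p ≤ g 0}
  have h0 : (0 : (Fin K → ℝ) × Matrix (Fin N) (Fin T) ℝ) ∈ S := by
    simp [S]
  have hScl : IsClosed S :=
    ((isClosed_rank_le R).preimage continuous_snd).inter (isClosed_le hg continuous_const)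
  have hg0 : g 0 = hsNormSq Y := by simp [g, linComb]
  obtain ⟨x, hx⟩ : ∃ x, ∀ k, ‖X k‖ ≤ x :=
    ⟨∑ k, ‖X k‖, fun k => Finset.single_le_sum (f := fun k => ‖X k‖) (fun _ _ => norm_nonneg _)
      (Finset.mem_univ k)⟩
  have hSbd : Bornology.IsBounded S := by
    have hy := hsNormSq_nonneg Y
    set a := 4 * hsNormSq Y with ha
    set c := √(a / (N * T * b)) with hc
    refine isBounded_iff_forall_norm_le.2 ⟨max c (√a + K * |x| * c), fun p hp => ?_⟩
    obtain ⟨hp1, hp2⟩ := hp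
    simp only [Set.mem_ofPred_eq] at hp1 hp2
    -- Parallelogram identity for `Y` and the residual, each of squared norm at most `hsNormSq Y`.
    have h1 : hsNormSq (linComb p.1 X + p.2) ≤ a := by
      have e1 := hsNormSq_add Y (-(Y - linComb p.1 X - p.2))
      have e2 := hsNormSq_add Y (Y - linComb p.1 X - p.2)
      have e3 := hsNormSq_nonneg (Y + (Y - linComb p.1 X - p.2))
      have e4 : Y + -(Y - linComb p.1 X - p.2) = linComb p.1 X + p.2 := by abel
      have e5 : hsNormSq (-(Y - linComb p.1 X - p.2)) = hsNormSq (Y - linComb p.1 X - p.2) := by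
        simp only [hsNormSq, Matrix.transpose_neg, Matrix.neg_mul, Matrix.mul_neg, neg_neg]
      rw [e4, e5, Matrix.mul_neg, Matrix.trace_neg] at e1
      rw [hg0] at hp2
      change hsNormSq (Y - linComb p.1 X - p.2) ≤ _ at hp2
      linarith
    have h2 : vecNorm p.1 ≤ c := by
      refine Real.le_sqrt_of_sq_le ?_
      rw [le_div_iff₀ (by positivity)]
      have := le_hsNormSq_linComb_add hNT hb p.1 (hp1.trans hq)
      linarith
    have hc0 : 0 ≤ c := Real.sqrt_nonneg _
    have h3 : ‖linComb p.1 X + p.2‖ ≤ √a := by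
      refine Real.le_sqrt_of_sq_le ?_
      refine (norm_sq_le_trace _).trans ?_
      rwa [← hsNormSq_eq]
    have h4 : ‖linComb p.1 X‖ ≤ K * |x| * c := by
      refine (norm_linComb_le fun k => (hx k).trans (le_abs_self x)).trans ?_
      gcongr
    refine max_le_max ?_ ?_
    · refine (pi_norm_le_iff_of_nonneg hc0).2 fun k => ?_
      exact (abs_le_vecNorm _ k).trans h2
    · have e : p.2 = (linComb p.1 X + p.2) - linComb p.1 X := by abel
      rw [e]
      exact norm_sub_le_of_le h3 h4
  have hSc : IsCompact S := Metric.isCompact_of_isClosed_isBounded hScl hSbd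
  obtain ⟨⟨β, G⟩, hmem, hmin⟩ := hSc.exists_isMinOn ⟨0, h0⟩ hg.continuousOn
  obtain ⟨L, F, hLF⟩ := exists_factorization hmem.1
  refine ⟨β, L, F, fun β' L' F' => ?_⟩
  change G = L * Fᵀ at hLF
  rw [← hLF]
  change g (β, G) ≤ g (β', L' * F'ᵀ)
  rcases le_or_gt (g (β', L' * F'ᵀ)) (g 0) with h | h
  · exact hmin ⟨rank_mul_transpose_le L' F', h⟩
  · exact hmem.2.trans h.le

end Existence

/-! ### Preliminary rate, and the terms of the score on regular samples -/

section Deterministic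

open scoped Matrix.Norms.L2Operator

variable {K N T R : ℕ}

/-- A realization of the data at which the regularity conditions hold with explicit constants. -/
structure RegularSample (X : Fin K → Matrix (Fin N) (Fin T) ℝ) (lam : Matrix (Fin N) (Fin R) ℝ)
    (f : Matrix (Fin T) (Fin R) ℝ) (e : Matrix (Fin N) (Fin T) ℝ) (b x c t a : ℝ) : Prop where
  size : 1 ≤ √((N : ℝ) * T)
  lam_det : IsUnit (lamᵀ * lam).det
  f_det : IsUnit (fᵀ * f).det
  norm_X : ∀ k, ‖X k‖ ≤ x * √((N : ℝ) * T)
  norm_e : ‖e‖ ≤ c * √√((N : ℝ) * T)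
  trace_X_e : ∀ k, |(eᵀ * X k).trace| ≤ t * √((N : ℝ) * T)
  norm_pinv : ‖factorPinv lam f‖ ≤ a / √((N : ℝ) * T)
  noncollinear : ∀ α : Fin K → ℝ, vecNorm α = 1 → b ≤ tailEig (R + R) (linComb α X)

theorem trace_mul_linComb (A : Matrix (Fin T) (Fin N) ℝ) (β : Fin K → ℝ)
    (X : Fin K → Matrix (Fin N) (Fin T) ℝ) :
    (A * linComb β X).trace = ∑ k, β k * (A * X k).trace := by
  simp [linComb, Matrix.mul_sum, Matrix.trace_sum]

theorem abs_trace_mul_linComb_le {A : Matrix (Fin T) (Fin N) ℝ} {β : Fin K → ℝ}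
    {X : Fin K → Matrix (Fin N) (Fin T) ℝ} {t : ℝ} (h : ∀ k, |(A * X k).trace| ≤ t) :
    |(A * linComb β X).trace| ≤ K * t * vecNorm β := by
  rw [trace_mul_linComb]
  refine (Finset.abs_sum_le_sum_abs _ _).trans ?_
  have h : ∀ k ∈ Finset.univ, |β k * (A * X k).trace| ≤ vecNorm β * t := fun k _ => by
    rw [abs_mul]
    exact mul_le_mul (abs_le_vecNorm β k) (h k) (abs_nonneg _) (vecNorm_nonneg β)
  refine (Finset.sum_le_sum h).trans (le_of_eq ?_)
  rw [Finset.sum_const, Finset.card_univ, Fintype.card_fin, nsmul_eq_mul]; ring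

theorem outcome_sub (β₀ β : Fin K → ℝ) (X : Fin K → Matrix (Fin N) (Fin T) ℝ)
    (lam L : Matrix (Fin N) (Fin R) ℝ) (f F : Matrix (Fin T) (Fin R) ℝ)
    (e : Matrix (Fin N) (Fin T) ℝ) :
    outcome β₀ X lam f e - linComb β X - L * Fᵀ
      = (e - linComb (β - β₀) X) + (lam * fᵀ - L * Fᵀ) := by
  rw [outcome, linComb_sub]; abel

theorem size_sq : √((N : ℝ) * T) ^ 2 = N * T := by
  have : (0 : ℝ) ≤ N * T := by positivity
  exact Real.sq_sqrt this

namespace RegularSample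

variable {X : Fin K → Matrix (Fin N) (Fin T) ℝ} {lam : Matrix (Fin N) (Fin R) ℝ}
  {f : Matrix (Fin T) (Fin R) ℝ} {e : Matrix (Fin N) (Fin T) ℝ} {b x c t a : ℝ}

theorem size_pos (h : RegularSample X lam f e b x c t a) : 0 < √((N : ℝ) * T) := by
  linarith [h.size]

theorem NT_pos (h : RegularSample X lam f e b x c t a) : 0 < (N : ℝ) * T :=
  Real.sqrt_pos.1 h.size_pos

theorem one_le_sqrt_size (h : RegularSample X lam f e b x c t a) : 1 ≤ √√((N : ℝ) * T) :=
  Real.one_le_sqrt.2 h.size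

theorem norm_linComb_le_size (h : RegularSample X lam f e b x c t a) (β : Fin K → ℝ) :
    ‖linComb β X‖ ≤ K * x * (√((N : ℝ) * T) * vecNorm β) :=
  (norm_linComb_le h.norm_X).trans (le_of_eq (by ring))

theorem exists_estimate (h : RegularSample X lam f e b x c t a) (hb : 0 < b)
    (Y : Matrix (Fin N) (Fin T) ℝ) : ∃ β, IsLSEstimate R Y X β :=
  exists_isLSEstimate (Nat.le_add_right R R) hb h.NT_pos h.noncollinear Y

/-- The least squares estimator converges at least at the rate `(NT)^(-1/4)`. -/
theorem preliminary_rate (h : RegularSample X lam f e b x c t a) (hb : 0 < b) (hx : 0 ≤ x)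
    (hc : 0 ≤ c) (ht : 0 ≤ t) {β₀ β : Fin K → ℝ}
    (hβ : IsLSEstimate R (outcome β₀ X lam f e) X β) :
    √((N : ℝ) * T) * vecNorm (β - β₀) ≤
      (√b)⁻¹ * (8 * R * c * (1 + K * x * (√b)⁻¹) + 2 * K * t * (√b)⁻¹) * √√((N : ℝ) * T) := by
  obtain ⟨L, F, hmin⟩ := hβ
  have h1 := hmin β₀ lam f
  rw [outcome_sub, outcome_sub, sub_self, sub_self, add_zero] at h1
  have hV0 : linComb (0 : Fin K → ℝ) X = 0 := by simp [linComb]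
  rw [hV0, sub_zero] at h1
  set s := √((N : ℝ) * T) with hs
  set D := lam * fᵀ - L * Fᵀ with hD
  set V := linComb (β - β₀) X with hV
  set u := s * vecNorm (β - β₀) with hu
  set g := (√b)⁻¹ with hg
  set w := √(hsNormSq (D - V)) with hw
  have hu0 : 0 ≤ u := mul_nonneg h.size_pos.le (vecNorm_nonneg _)
  have hg0 : 0 ≤ g := by positivity
  have hw0 : 0 ≤ w := Real.sqrt_nonneg _
  have hw2 : w ^ 2 = hsNormSq (D - V) := Real.sq_sqrt (hsNormSq_nonneg _)
  have hDr : D.rank ≤ R + R :=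
    rank_sub_le_of_le (rank_mul_transpose_le _ _) (rank_mul_transpose_le _ _)
  have hVn : ‖V‖ ≤ K * x * u := h.norm_linComb_le_size _
  -- Noncollinearity applies to `V - D` because `D` has rank at most `2R`.
  have huw : u ≤ g * w := by
    have h2 := le_hsNormSq_linComb_add h.NT_pos h.noncollinear (β - β₀) (B := -D)
      ((rank_neg_eq D).le.trans hDr)
    have h3 : hsNormSq (linComb (β - β₀) X + -D) = hsNormSq (D - V) := by
      rw [← hV, ← sub_eq_add_neg, ← neg_sub D V]
      simp only [hsNormSq, Matrix.transpose_neg, Matrix.neg_mul, Matrix.mul_neg, neg_neg]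
    rw [h3, ← hw2, ← size_sq, ← hs] at h2
    have h4 : (√b * u) ^ 2 ≤ w ^ 2 := by
      rw [mul_pow, Real.sq_sqrt hb.le, hu]; nlinarith
    have h5 := abs_le_of_sq_le_sq' h4 hw0 |>.2
    rw [hg, inv_mul_eq_div, le_div_iff₀ (Real.sqrt_pos.2 hb)]
    linarith
  have hMw : ‖D - V‖ ≤ w := by
    refine Real.le_sqrt_of_sq_le ((norm_sq_le_trace _).trans ?_)
    rw [hsNormSq_eq]
  have hDn : ‖D‖ ≤ w + K * x * u := by
    have : D = (D - V) + V := by abel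
    rw [this]
    exact norm_add_le_of_le hMw hVn
  have h2 : e - V + D = e + (D - V) := by abel
  rw [h2, hsNormSq_add, Matrix.mul_sub, Matrix.trace_sub, ← hw2] at h1
  have hD1 := abs_trace_transpose_mul_le e D hDr
  have hV1 : |(eᵀ * V).trace| ≤ K * t * u :=
    (abs_trace_mul_linComb_le h.trace_X_e).trans (le_of_eq (by rw [hu]; ring))
  have hD2 : ‖e‖ * ‖D‖ ≤ c * √s * (w + K * x * (g * w)) := by
    refine mul_le_mul h.norm_e (hDn.trans ?_) (norm_nonneg _) (by positivity)
    gcongr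
  have hD3 : 2 * ((R + R : ℕ) : ℝ) * (‖e‖ * ‖D‖)
      ≤ 4 * R * (c * √s * (w + K * x * (g * w))) := by
    push_cast
    have := mul_le_mul_of_nonneg_left hD2 (by positivity : (0 : ℝ) ≤ 4 * R)
    linarith
  have hV2 : K * t * u ≤ K * t * (g * w) := by gcongr
  have hs1 : 1 ≤ √s := h.one_le_sqrt_size
  have hV3 : K * t * (g * w) ≤ K * t * (g * w) * √s :=
    le_mul_of_one_le_right (by positivity) hs1
  have h3 := neg_abs_le (eᵀ * D).trace
  have h4 := le_abs_self (eᵀ * V).trace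
  -- Minimality gives `w² ≤ 2|Tr(e'D)| + 2|Tr(e'V)|`. The first trace uses the low rank of `D`, the
  -- second the bound on `Tr(X_k'e)`; both are linear in `w`.
  have h5 : w * w ≤ w * ((8 * R * c * (1 + K * x * g) + 2 * K * t * g) * √s) := by
    nlinarith
  have h6 : w ≤ (8 * R * c * (1 + K * x * g) + 2 * K * t * g) * √s := by
    rcases hw0.eq_or_lt with h0 | h0
    · rw [← h0]; positivity
    · exact le_of_mul_le_mul_left h5 h0
  calc u ≤ g * w := huw
    _ ≤ g * ((8 * R * c * (1 + K * x * g) + 2 * K * t * g) * √s) := by gcongr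
    _ = _ := by ring

/-- The quadratic form of `W` at `α` is the squared norm of the doubly projected `α·X` over `NT`.
Projecting changes `α·X` by rank at most `2R`, so noncollinearity bounds the form below by `b‖α‖²`;
Cauchy-Schwarz does the rest. -/
theorem vecNorm_le_mulVec_Wmat (h : RegularSample X lam f e b x c t a) (α : Fin K → ℝ) :
    b * vecNorm α ≤ vecNorm (Wmat X lam f *ᵥ α) := by
  set M : Matrix (Fin N) (Fin N) ℝ := 1 - colProj lam with hM
  set Q : Matrix (Fin T) (Fin T) ℝ := 1 - colProj f with hQ
  have hMs : Mᵀ = M := by simp [hM, colProj_transpose]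
  have hQs : Qᵀ = Q := by simp [hQ, colProj_transpose]
  have hMi : M * M = M := by
    rw [hM]; noncomm_ring [colProj_idem h.lam_det]
  have hQi : Q * Q = Q := by
    rw [hQ]; noncomm_ring [colProj_idem h.f_det]
  set A := linComb α X with hA
  have hquad : α ⬝ᵥ (Wmat X lam f *ᵥ α) = 1 / ((N : ℝ) * T) * hsNormSq (M * A * Q) := by
    have h1 : hsNormSq (M * A * Q) = (M * A * Q * Aᵀ).trace := by
      calc hsNormSq (M * A * Q) = (M * A * (Q * Q) * Aᵀ * M).trace := by
            rw [hsNormSq, Matrix.transpose_mul, Matrix.transpose_mul, hMs, hQs]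
            simp only [Matrix.mul_assoc]
        _ = (M * M * A * Q * Aᵀ).trace := by
            rw [hQi, Matrix.trace_mul_comm]; simp only [Matrix.mul_assoc]
        _ = _ := by rw [hMi]
    rw [h1]
    have h2 : (M * A * Q * Aᵀ).trace = ∑ i, ∑ j, α i * (α j * (M * X i * Q * (X j)ᵀ).trace) := by
      simp only [hA, linComb, Matrix.transpose_sum, Matrix.mul_sum, Matrix.sum_mul,
        Matrix.trace_sum, Matrix.transpose_smul, Matrix.mul_smul, Matrix.smul_mul,
        Matrix.trace_smul, smul_eq_mul, Finset.mul_sum]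
      rw [Finset.sum_comm]
      exact Finset.sum_congr rfl fun i _ => Finset.sum_congr rfl fun j _ => by ring
    rw [h2, Finset.mul_sum]
    simp only [dotProduct, Matrix.mulVec, Wmat, Matrix.of_apply, annih_eq h.lam_det,
      annih_eq h.f_det, Finset.mul_sum]
    exact Finset.sum_congr rfl fun i _ => Finset.sum_congr rfl fun j _ => by ring
  have hlow : b * vecNorm α ^ 2 ≤ α ⬝ᵥ (Wmat X lam f *ᵥ α) := by
    have h1 : M * A * Q = A + (-(colProj lam * A) + -(M * A * colProj f)) := by
      simp only [hM, hQ, Matrix.mul_sub, Matrix.sub_mul, Matrix.mul_one, Matrix.one_mul]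
      abel
    have h2 := le_hsNormSq_linComb_add h.NT_pos h.noncollinear α
      (B := -(colProj lam * A) + -(M * A * colProj f)) (by
        refine rank_add_le_of_le ((rank_neg_eq _).le.trans ?_) ((rank_neg_eq _).le.trans ?_)
        · exact (Matrix.rank_mul_le_left _ _).trans (by simpa using rank_colProj_le lam)
        · exact (Matrix.rank_mul_le_right _ _).trans (by simpa using rank_colProj_le f))
    rw [← h1] at h2
    rw [hquad, one_div, inv_mul_eq_div, le_div_iff₀ h.NT_pos]
    linarith
  have hCS : α ⬝ᵥ (Wmat X lam f *ᵥ α) ≤ vecNorm α * vecNorm (Wmat X lam f *ᵥ α) := by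
    have := real_inner_le_norm (WithLp.toLp 2 α) (WithLp.toLp 2 (Wmat X lam f *ᵥ α))
    rw [EuclideanSpace.inner_toLp_toLp] at this
    simpa [vecNorm, dotProduct_comm] using this
  rcases (vecNorm_nonneg α).eq_or_lt with h0 | h0
  · rw [← h0, mul_zero]; exact vecNorm_nonneg _
  · refine le_of_mul_le_mul_left ?_ h0
    nlinarith

theorem isUnit_Wmat (h : RegularSample X lam f e b x c t a) (hb : 0 < b) :
    IsUnit (Wmat X lam f) := by
  rw [← Matrix.mulVec_injective_iff_isUnit]
  intro α α' hα
  have h1 := h.vecNorm_le_mulVec_Wmat (α - α')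
  have h2 : Wmat X lam f *ᵥ (α - α') = 0 := by rw [Matrix.mulVec_sub, sub_eq_zero]; exact hα
  have h3 : vecNorm (0 : Fin K → ℝ) = 0 := by simp [vecNorm]
  rw [h2, h3] at h1
  have h4 : vecNorm (α - α') = 0 :=
    le_antisymm (by nlinarith [vecNorm_nonneg (α - α')]) (vecNorm_nonneg _)
  exact sub_eq_zero.1 (vecNorm_eq_zero h4)

theorem vecNorm_inv_Wmat_mulVec_le (h : RegularSample X lam f e b x c t a) (hb : 0 < b)
    (v : Fin K → ℝ) : vecNorm ((Wmat X lam f)⁻¹ *ᵥ v) ≤ b⁻¹ * vecNorm v := by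
  have h1 := h.vecNorm_le_mulVec_Wmat ((Wmat X lam f)⁻¹ *ᵥ v)
  rw [Matrix.mulVec_mulVec, Matrix.mul_nonsing_inv _
    ((Matrix.isUnit_iff_isUnit_det _).1 (h.isUnit_Wmat hb)), Matrix.one_mulVec] at h1
  rwa [inv_mul_eq_div, le_div_iff₀ hb, mul_comm]

theorem trace_compl_mul (h : RegularSample X lam f e b x c t a) (k : Fin K) :
    ((X k)ᵀ * ((1 - colProj lam) * e * (1 - colProj f))).trace
      = √((N : ℝ) * T) * C1 X lam f e k := by
  rw [C1, ← mul_assoc, mul_one_div_cancel h.size_pos.ne', one_mul, annih_eq h.lam_det,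
    annih_eq h.f_det, ← Matrix.trace_transpose]
  simp only [Matrix.transpose_mul, Matrix.transpose_sub, Matrix.transpose_one, colProj_transpose,
    Matrix.transpose_transpose, Matrix.mul_assoc]
  rw [← Matrix.mul_assoc (1 - colProj f), Matrix.trace_mul_comm]
  simp only [Matrix.mul_assoc]

theorem trace_compl_linComb (h : RegularSample X lam f e b x c t a) (α : Fin K → ℝ) (k : Fin K) :
    ((X k)ᵀ * ((1 - colProj lam) * linComb α X * (1 - colProj f))).trace
      = √((N : ℝ) * T) ^ 2 * (Wmat X lam f *ᵥ α) k := by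
  have h1 : ((X k)ᵀ * ((1 - colProj lam) * linComb α X * (1 - colProj f))).trace
      = (((1 - colProj f) * (X k)ᵀ * (1 - colProj lam)) * linComb α X).trace := by
    rw [← Matrix.mul_assoc, Matrix.trace_mul_comm]
    simp only [Matrix.mul_assoc]
  rw [h1, trace_mul_linComb, Matrix.mulVec, dotProduct, Finset.mul_sum]
  refine Finset.sum_congr rfl fun j _ => ?_
  rw [Wmat, Matrix.of_apply, size_sq, ← mul_assoc, ← mul_assoc,
    mul_one_div_cancel h.NT_pos.ne', one_mul, mul_comm, annih_eq h.lam_det, annih_eq h.f_det]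
  congr 1
  rw [← Matrix.trace_transpose]
  simp only [Matrix.transpose_mul, Matrix.transpose_sub, Matrix.transpose_one, colProj_transpose,
    Matrix.transpose_transpose]
  rw [Matrix.trace_mul_comm]
  simp only [Matrix.mul_assoc]

/-- By transposition and cyclicity of the trace, the three terms of `C2` are those of `quadTerm` in
reverse order. -/
theorem trace_quadTerm (h : RegularSample X lam f e b x c t a) (k : Fin K) :
    ((X k)ᵀ * quadTerm (colProj lam) (colProj f) (factorPinv lam f) e e).trace
      = -(√((N : ℝ) * T) * C2 X lam f e k) := by
  rw [C2, mul_neg, neg_neg, ← mul_assoc, mul_one_div_cancel h.size_pos.ne', one_mul,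
    annih_eq h.lam_det, annih_eq h.f_det, ← factorPinv_transpose lam f]
  set M : Matrix (Fin N) (Fin N) ℝ := 1 - colProj lam with hM
  set Q : Matrix (Fin T) (Fin T) ℝ := 1 - colProj f with hQ
  have hMs : Mᵀ = M := by simp [hM, colProj_transpose]
  have hQs : Qᵀ = Q := by simp [hQ, colProj_transpose]
  rw [← factorPinv]
  set B := factorPinv lam f with hB
  have e1 : (e * Q * eᵀ * M * X k * B).trace = ((X k)ᵀ * (M * e * Q * eᵀ * Bᵀ)).trace := by
    rw [← Matrix.trace_transpose]
    simp only [Matrix.transpose_mul, Matrix.transpose_transpose, hMs, hQs]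
    rw [Matrix.trace_mul_comm]
    simp only [Matrix.mul_assoc]
  have e2 : (eᵀ * M * e * Q * (X k)ᵀ * Bᵀ).trace = ((X k)ᵀ * (Bᵀ * eᵀ * M * e * Q)).trace := by
    rw [Matrix.mul_assoc _ (X k)ᵀ, Matrix.trace_mul_comm]
    simp only [Matrix.mul_assoc]
  have e3 : (eᵀ * M * X k * Q * eᵀ * Bᵀ).trace = ((X k)ᵀ * (M * e * B * e * Q)).trace := by
    rw [← Matrix.trace_transpose]
    simp only [Matrix.transpose_mul, Matrix.transpose_transpose, hMs, hQs]
    have : B * (e * (Q * ((X k)ᵀ * (M * e)))) = (B * e * Q) * ((X k)ᵀ * (M * e)) := by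
      simp only [Matrix.mul_assoc]
    rw [this, Matrix.trace_mul_comm]
    simp only [Matrix.mul_assoc]
  rw [e1, e2, e3, quadTerm, ← hM, ← hQ, Matrix.mul_add, Matrix.mul_add, Matrix.trace_add,
    Matrix.trace_add]
  ring

end RegularSample

end Deterministic

/-! ### The score expansion with explicit constants -/

section Deterministic

open scoped Matrix.Norms.L2Operator

variable {K N T R : ℕ}

/-- Bookkeeping of powers of `s`: the first summand is the cubic remainder (rank `7R`), the second
the cost of replacing `E` by `e` in the quadratic term (rank `6R`). Relative to `s`, both are of
order `1/√s`, the second with a factor `u`. -/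
theorem score_remainder_rate {R x s a d k u : ℝ} (hs : 0 < s) :
    2 * (7 * R) * (x * s * (40 * (a / s) ^ 2 * (d * √s) ^ 3))
      + 2 * (6 * R) * (x * s * (6 * (a / s) * (d * √s) * (k * x * u)))
      = s * ((560 * R * x * a ^ 2 * d ^ 3 + 72 * R * x ^ 2 * k * a * d * u) / √s) := by
  obtain ⟨r, hr, rfl⟩ : ∃ r : ℝ, 0 < r ∧ s = r ^ 2 :=
    ⟨√s, Real.sqrt_pos.2 hs, (Real.sq_sqrt hs.le).symm⟩
  rw [Real.sqrt_sq hr.le]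
  field_simp
  ring

namespace RegularSample

variable {X : Fin K → Matrix (Fin N) (Fin T) ℝ} {lam : Matrix (Fin N) (Fin R) ℝ}
  {f : Matrix (Fin T) (Fin R) ℝ} {e : Matrix (Fin N) (Fin T) ℝ} {b x c t a : ℝ}

theorem rank_pinv_le (lam : Matrix (Fin N) (Fin R) ℝ) (f : Matrix (Fin T) (Fin R) ℝ) :
    (factorPinv lam f).rank ≤ R := by
  simpa using rank_factorPinv_le lam f

/-- `C⁽²⁾` is bounded on regular samples. -/
theorem vecNorm_C2_le (h : RegularSample X lam f e b x c t a) :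
    vecNorm (C2 X lam f e) ≤ K * (18 * R * x * a * c ^ 2) := by
  refine vecNorm_le_of_forall_abs_le fun k => ?_
  -- The trivial perturbation `D = 0`, `E = 0` suffices, since the bound on `quadTerm` involves only
  -- `P`, `Q` and `B`.
  obtain ⟨A, hA⟩ := exists_lowRankPerturbation (L := lam) (F := f) (E := 0) h.lam_det h.f_det
    (by simp) (by simp) (by simp)
  have h1 := abs_trace_transpose_mul_le (X k)
    (quadTerm (colProj lam) (colProj f) (factorPinv lam f) e e)
    (LowRankPerturbation.rank_quadTerm_le (rank_pinv_le lam f) e e)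
  rw [h.trace_quadTerm, abs_neg, abs_mul, abs_of_pos h.size_pos] at h1
  have h2 := hA.norm_quadTerm_le h.norm_pinv h.norm_e h.norm_e
  have h3 := mul_le_mul (h.norm_X k) h2 (norm_nonneg _) ((norm_nonneg _).trans (h.norm_X k))
  set s := √((N : ℝ) * T) with hs
  have hs0 : 0 < s := h.size_pos
  have h4 : s * |C2 X lam f e k| ≤ s * (18 * R * x * a * c ^ 2) := by
    calc s * |C2 X lam f e k| ≤ 2 * ((3 * R : ℕ) : ℝ) *
          (x * s * (3 * (a / s) * (c * √s) * (c * √s))) :=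
          h1.trans (mul_le_mul_of_nonneg_left h3 (by positivity))
      _ = s * (18 * R * x * a * c ^ 2) * ((√s) ^ 2 / s) := by
          push_cast; field_simp; ring
      _ = _ := by rw [Real.sq_sqrt hs0.le, div_self hs0.ne', mul_one]
  exact le_of_mul_le_mul_left h4 hs0

/-- The score equation, with a remainder controlled by the preliminary rate `g`. -/
theorem score_expansion (h : RegularSample X lam f e b x c t a) (hx : 0 ≤ x)
    (hc : 0 ≤ c) {β₀ β : Fin K → ℝ}
    (hβ : IsLSEstimate R (outcome β₀ X lam f e) X β) {g d : ℝ} (hg : 0 ≤ g)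
    (hrate : √((N : ℝ) * T) * vecNorm (β - β₀) ≤ g * √√((N : ℝ) * T))
    (hd : d = (1 + 8 * R) * (c + K * x * g)) (hlarge : 2 * (a * d) ≤ √√((N : ℝ) * T)) (k : Fin K) :
    |(Wmat X lam f *ᵥ (√((N : ℝ) * T) • (β - β₀)) - (C1 X lam f e + C2 X lam f e)) k| ≤
      (72 * R * x ^ 2 * K * a * d + 560 * R * x * a ^ 2 * d ^ 3) / √√((N : ℝ) * T) *
        (1 + √((N : ℝ) * T) * vecNorm (β - β₀)) := by
  obtain ⟨L, F, hmin⟩ := hβ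
  obtain ⟨hL, hF, hXk⟩ := first_order_conditions hmin
  have hlf := hmin β lam f
  rw [outcome_sub, outcome_sub, sub_self, add_zero] at hlf
  rw [outcome_sub] at hL hF hXk
  set V := linComb (β - β₀) X with hV
  set E := e - V with hE
  set D := lam * fᵀ - L * Fᵀ with hD
  have hVn : ‖V‖ ≤ K * x * (√((N : ℝ) * T) * vecNorm (β - β₀)) := h.norm_linComb_le_size _
  have hen := h.norm_e
  have hBn := h.norm_pinv
  have hs0 := h.size_pos
  have hs1 := h.one_le_sqrt_size
  have hXn := h.norm_X k
  have tC1 := h.trace_compl_mul k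
  have tW := h.trace_compl_linComb (β - β₀) k
  have tC2 := h.trace_quadTerm k
  set s := √((N : ℝ) * T) with hs
  set u := s * vecNorm (β - β₀) with hu
  have hu0 : 0 ≤ u := mul_nonneg hs0.le (vecNorm_nonneg _)
  have ha0 : 0 ≤ a := by
    have := (norm_nonneg _).trans hBn
    rw [le_div_iff₀ hs0, zero_mul] at this
    exact this
  have hss : √s ^ 2 = s := Real.sq_sqrt hs0.le
  have hd0 : 0 ≤ d := by rw [hd]; positivity
  have hE0 : ‖E‖ ≤ (c + K * x * g) * √s := by
    refine (norm_sub_le_of_le hen (hVn.trans (mul_le_mul_of_nonneg_left hrate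
      (by positivity)))).trans (le_of_eq (by ring))
  have hR : 0 ≤ (R : ℝ) * ((c + K * x * g) * √s) := by positivity
  have hEd : ‖E‖ ≤ d * √s := by rw [hd]; linarith
  have hed : ‖e‖ ≤ d * √s := by
    have : 0 ≤ K * x * g * √s := by positivity
    rw [hd]; linarith
  have hDr : D.rank ≤ 2 * R :=
    (rank_sub_le_of_le (rank_mul_transpose_le _ _) (rank_mul_transpose_le _ _)).trans (by omega)
  -- Keeping `β` and returning to the true factors cannot lower the objective, so `‖D‖ ≤ 8R‖E‖`;
  -- this is the `8 * R` in `d`.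
  have hDd : ‖D‖ ≤ d * √s := by
    have h1 := norm_le_of_hsNormSq_add_le hDr hlf
    have h2 := mul_le_mul_of_nonneg_left hE0 (by positivity : (0 : ℝ) ≤ 8 * R)
    have h3 : 0 ≤ (c + K * x * g) * √s := by positivity
    push_cast at h1
    rw [hd]; linarith
  have hsmall : a / s * (d * √s) ≤ 1 / 2 := by
    have : a / s * (d * √s) = a * d / √s := by
      rw [div_mul_eq_mul_div, div_eq_div_iff hs0.ne' (by positivity)]
      linear_combination (a * d) * hss
    rw [this, div_le_iff₀ (by positivity)]
    linarith
  obtain ⟨A, hA⟩ := exists_lowRankPerturbation (L := L) (F := F) (E := E) h.lam_det h.f_det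
    ((mul_le_mul hBn hDd (norm_nonneg _) (by positivity)).trans hsmall) hL hF
  have r1 := hA.norm_remainder_le hEd hDd hBn hsmall
  have r2 := hA.norm_quadTerm_sub_le hBn hEd hed
  have k1 := hA.rank_remainder_le (rank_pinv_le lam f) hDr
  have k2 : (quadTerm (colProj lam) (colProj f) (factorPinv lam f) E E
      - quadTerm (colProj lam) (colProj f) (factorPinv lam f) e e).rank ≤ 6 * R :=
    (rank_sub_le_of_le (LowRankPerturbation.rank_quadTerm_le (rank_pinv_le lam f) E E)
      (LowRankPerturbation.rank_quadTerm_le (rank_pinv_le lam f) e e)).trans (by omega)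
  have hEe : ‖E - e‖ ≤ K * x * u := by
    have : E - e = -V := by rw [hE]; abel
    rwa [this, norm_neg]
  have t1 := (abs_trace_transpose_mul_le (X k) _ k1).trans (mul_le_mul_of_nonneg_left
    (mul_le_mul hXn r1 (norm_nonneg _) (by positivity)) (by positivity))
  have t2 := (abs_trace_transpose_mul_le (X k) _ k2).trans (mul_le_mul_of_nonneg_left
    (mul_le_mul hXn (r2.trans (mul_le_mul_of_nonneg_left hEe (by positivity)))
      (norm_nonneg _) (by positivity)) (by positivity))
  have hMEN : (1 - colProj lam) * E * (1 - colProj f) = (1 - colProj lam) * e * (1 - colProj f)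
      - (1 - colProj lam) * V * (1 - colProj f) := by
    rw [hE, Matrix.mul_sub _ e V, Matrix.sub_mul _ _ (1 - colProj f)]
  rw [Matrix.mul_sub, Matrix.trace_sub, hXk, Matrix.mul_sub, Matrix.trace_sub, hMEN,
    Matrix.mul_sub (X k)ᵀ, Matrix.trace_sub, tC1, tW] at t1
  rw [Matrix.mul_sub, Matrix.trace_sub, tC2] at t2
  set q := ((X k)ᵀ * quadTerm (colProj lam) (colProj f) (factorPinv lam f) E E).trace with hq
  -- The score `Tr(X_k'U) = 0` is the leading `0`; `q` cancels between the two error terms bounded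
  -- by `t1` and `t2`.
  have hgoal : s * ((Wmat X lam f *ᵥ (s • (β - β₀)) - (C1 X lam f e + C2 X lam f e)) k)
      = (0 - (s * C1 X lam f e k - s ^ 2 * (Wmat X lam f *ᵥ (β - β₀)) k - q))
        - (q - -(s * C2 X lam f e k)) := by
    simp only [Matrix.mulVec_smul, Pi.sub_apply, Pi.add_apply, Pi.smul_apply, smul_eq_mul]
    ring
  have hbound := (abs_sub _ _).trans (add_le_add t1 t2)
  rw [← hgoal, abs_mul, abs_of_pos hs0] at hbound
  refine le_of_mul_le_mul_left (hbound.trans ?_) hs0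
  push_cast
  have hr0 : 0 < √s := by positivity
  rw [score_remainder_rate hs0]
  refine mul_le_mul_of_nonneg_left ?_ hs0.le
  rw [div_mul_eq_mul_div]
  refine div_le_div_of_nonneg_right ?_ hr0.le
  have p1 : 0 ≤ 560 * R * x * a ^ 2 * d ^ 3 * u := by positivity
  have p2 : 0 ≤ 72 * R * x ^ 2 * K * a * d := by positivity
  linarith

end RegularSample

/-- The asymptotic expansion of the least squares estimator on regular samples, with constants
that depend on the regularity constants only. -/
theorem exists_expansion_constants (K R : ℕ) {b x c t a : ℝ} (hb : 0 < b) (hx : 0 ≤ x)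
    (hc : 0 ≤ c) (ht : 0 ≤ t) (ha : 0 ≤ a) :
    ∃ H s₀ : ℝ, ∀ {N T : ℕ} {X : Fin K → Matrix (Fin N) (Fin T) ℝ}
      {lam : Matrix (Fin N) (Fin R) ℝ} {f : Matrix (Fin T) (Fin R) ℝ}
      {e : Matrix (Fin N) (Fin T) ℝ}, RegularSample X lam f e b x c t a →
      s₀ ≤ √√((N : ℝ) * T) → ∀ {β₀ β : Fin K → ℝ},
      IsLSEstimate R (outcome β₀ X lam f e) X β →
      vecNorm (√((N : ℝ) * T) • (β - β₀)
          - (Wmat X lam f)⁻¹ *ᵥ (C1 X lam f e + C2 X lam f e))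
        ≤ H / √√((N : ℝ) * T) * (1 + vecNorm (C1 X lam f e)) := by
  obtain ⟨g, hg⟩ : ∃ g : ℝ, g = (√b)⁻¹ * (8 * R * c * (1 + K * x * (√b)⁻¹) + 2 * K * t * (√b)⁻¹) := ⟨_, rfl⟩
  obtain ⟨d, hd⟩ : ∃ d : ℝ, d = (1 + 8 * R) * (c + K * x * g) := ⟨_, rfl⟩
  obtain ⟨G, hG⟩ : ∃ G : ℝ, G = 72 * R * x ^ 2 * K * a * d + 560 * R * x * a ^ 2 * d ^ 3 := ⟨_, rfl⟩
  obtain ⟨κ, hκ⟩ : ∃ κ : ℝ, κ = K * (18 * R * x * a * c ^ 2) := ⟨_, rfl⟩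
  have hg0 : 0 ≤ g := by rw [hg]; positivity
  have hd0 : 0 ≤ d := by rw [hd]; positivity
  have hG0 : 0 ≤ G := by rw [hG]; positivity
  have hκ0 : 0 ≤ κ := by rw [hκ]; positivity
  refine ⟨b⁻¹ * (K * G) * (2 + 2 * b⁻¹ * (1 + κ)), max (2 * (a * d)) (2 * b⁻¹ * (K * G)), ?_⟩
  intro N T X lam f e h hlarge β₀ β hβ
  have hrate := h.preliminary_rate hb hx hc ht hβ
  rw [← hg] at hrate
  have hscore := fun k => h.score_expansion hx hc hβ hg0 hrate hd
    ((le_max_left _ _).trans hlarge) k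
  have hl2 := (le_max_right _ _).trans hlarge
  have hC2 := h.vecNorm_C2_le
  rw [← hκ] at hC2
  have hs0 := h.size_pos
  have hlow := h.vecNorm_le_mulVec_Wmat (√((N : ℝ) * T) • (β - β₀))
  have hinv := h.vecNorm_inv_Wmat_mulVec_le hb
  have hWu := h.isUnit_Wmat hb
  set W := Wmat X lam f with hW
  set C := C1 X lam f e with hC
  set C' := C2 X lam f e with hC'
  set s := √((N : ℝ) * T) with hs
  set z := s • (β - β₀) with hz
  have hzu : s * vecNorm (β - β₀) = vecNorm z := by rw [hz, vecNorm_smul, abs_of_pos hs0]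
  rw [hzu] at hscore
  rw [← hG] at hscore
  have hr0 : 0 < √s := Real.sqrt_pos.2 hs0
  have hz0 := vecNorm_nonneg z
  have hC0 := vecNorm_nonneg C
  have hv := vecNorm_le_of_forall_abs_le hscore
  set v := W *ᵥ z - (C + C') with hvdef
  -- The second lower bound on `√s` makes the coefficient of `‖z‖` in the error at most `b / 2`,
  -- half of what `W` provides.
  have hzbound : vecNorm z ≤ 1 + 2 * b⁻¹ * (vecNorm C + κ) := by
    have h1 : W *ᵥ z = v + (C + C') := by rw [hvdef]; abel
    have h2 : b * vecNorm z ≤ K * (G / √s * (1 + vecNorm z)) + (vecNorm C + κ) := by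
      refine hlow.trans ?_
      rw [h1]
      refine (vecNorm_add_le _ _).trans (add_le_add hv ((vecNorm_add_le _ _).trans ?_))
      linarith
    have h3 : K * (G / √s) ≤ b / 2 := by
      rw [← mul_div_assoc, div_le_iff₀ hr0]
      have := mul_le_mul_of_nonneg_left hl2 (by positivity : 0 ≤ b / 2)
      have e : b / 2 * (2 * b⁻¹ * (K * G)) = K * G := by field_simp
      linarith
    have h4 : K * (G / √s * (1 + vecNorm z)) ≤ b / 2 * (1 + vecNorm z) := by
      rw [← mul_assoc]; gcongr
    have h5 : b * vecNorm z ≤ b * (1 + 2 * b⁻¹ * (vecNorm C + κ)) := by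
      have e : b * (1 + 2 * b⁻¹ * (vecNorm C + κ)) = b + 2 * (vecNorm C + κ) := by field_simp
      rw [e]; linarith
    exact le_of_mul_le_mul_left h5 hb
  have hdiff : z - W⁻¹ *ᵥ (C + C') = W⁻¹ *ᵥ v := by
    rw [hvdef, Matrix.mulVec_sub, Matrix.mulVec_mulVec,
      Matrix.nonsing_inv_mul _ ((Matrix.isUnit_iff_isUnit_det _).1 hWu), Matrix.one_mulVec]
  have hbi : 0 ≤ b⁻¹ := by positivity
  rw [hdiff]
  calc vecNorm (W⁻¹ *ᵥ v) ≤ b⁻¹ * (K * (G / √s * (1 + vecNorm z))) :=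
        (hinv v).trans (mul_le_mul_of_nonneg_left hv hbi)
    _ ≤ b⁻¹ * (K * (G / √s * ((2 + 2 * b⁻¹ * (1 + κ)) * (1 + vecNorm C)))) := by
        gcongr
        have : 0 ≤ b⁻¹ * κ * vecNorm C := by positivity
        nlinarith
    _ = _ := by ring

end Deterministic

/-! ### Calculus of stochastic orders -/

section Probability

variable {Ω : ℕ → Type*} [∀ n, MeasurableSpace (Ω n)] {μ : ∀ n, Measure (Ω n)}

theorem tendsto_zero_of_forall_eventually_le {u : ℕ → ℝ} (h0 : ∀ n, 0 ≤ u n)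
    (h : ∀ ε > 0, ∀ᶠ n in atTop, u n ≤ ε) : Tendsto u atTop (𝓝 0) := by
  refine Metric.tendsto_nhds.2 fun ε hε => ?_
  filter_upwards [h (ε / 2) (by positivity)] with n hn
  rw [Real.dist_0_eq_abs, abs_of_nonneg (h0 n)]
  linarith

theorem WPA1.eventually_le {A : ∀ n, Ω n → Prop} (h : WPA1 μ A) {ε : ℝ} (hε : 0 < ε) :
    ∀ᶠ n in atTop, (μ n).real {ω | ¬ A n ω} ≤ ε := by
  filter_upwards [h.eventually (gt_mem_nhds hε)] with n hn using hn.le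

/-- Exceptional sets need not be measurable: monotonicity and subadditivity hold for the outer
measure. -/
theorem measureReal_not_and_le {α : Type*} [MeasurableSpace α] (ν : Measure α)
    [IsProbabilityMeasure ν] (p q : α → Prop) :
    ν.real {ω | ¬ (p ω ∧ q ω)} ≤ ν.real {ω | ¬ p ω} + ν.real {ω | ¬ q ω} := by
  refine le_trans (measureReal_mono ?_) (measureReal_union_le _ _)
  intro ω hω
  by_cases hp : p ω
  · exact Or.inr fun hq => hω ⟨hp, hq⟩
  · exact Or.inl hp

theorem measureReal_not_forall_le {α : Type*} [MeasurableSpace α] (ν : Measure α)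
    [IsProbabilityMeasure ν] {K : ℕ} (p : Fin K → α → Prop) :
    ν.real {ω | ¬ ∀ k, p k ω} ≤ ∑ k, ν.real {ω | ¬ p k ω} := by
  have h : {ω | ¬ ∀ k, p k ω} = ⋃ k, {ω | ¬ p k ω} := by
    ext ω; simp
  rw [h]
  exact measureReal_iUnion_fintype_le _

variable [∀ n, IsProbabilityMeasure (μ n)]

theorem eventually_le_of_imp {A B : ∀ n, Ω n → Prop} {ε : ℝ}
    (h : ∀ᶠ n in atTop, (μ n).real {ω | ¬ A n ω} ≤ ε)
    (himp : ∀ᶠ n in atTop, ∀ ω, A n ω → B n ω) :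
    ∀ᶠ n in atTop, (μ n).real {ω | ¬ B n ω} ≤ ε := by
  filter_upwards [h, himp] with n hn hi
  refine le_trans (measureReal_mono ?_) hn
  intro ω hω hA
  exact hω (hi ω hA)

theorem eventually_and_le {A B : ∀ n, Ω n → Prop} {ε δ : ℝ}
    (hA : ∀ᶠ n in atTop, (μ n).real {ω | ¬ A n ω} ≤ ε)
    (hB : ∀ᶠ n in atTop, (μ n).real {ω | ¬ B n ω} ≤ δ) :
    ∀ᶠ n in atTop, (μ n).real {ω | ¬ (A n ω ∧ B n ω)} ≤ ε + δ := by
  filter_upwards [hA, hB] with n h1 h2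
  exact (measureReal_not_and_le _ _ _).trans (add_le_add h1 h2)

theorem eventually_and_ae {A B : ∀ n, Ω n → Prop} {ε : ℝ}
    (hA : ∀ᶠ n in atTop, (μ n).real {ω | ¬ A n ω} ≤ ε) (hB : ∀ n, ∀ᵐ ω ∂(μ n), B n ω) :
    ∀ᶠ n in atTop, (μ n).real {ω | ¬ (A n ω ∧ B n ω)} ≤ ε := by
  have hB' : ∀ᶠ n in atTop, (μ n).real {ω | ¬ B n ω} ≤ 0 := by
    refine Eventually.of_forall fun n => le_of_eq ?_
    rw [measureReal_def, ae_iff.1 (hB n), ENNReal.toReal_zero]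
  simpa using eventually_and_le hA hB'

theorem IsBigOP.exists_bound {Z r : ∀ n, Ω n → ℝ} (h : IsBigOP μ Z r) (hr : ∀ n ω, 0 ≤ r n ω)
    {ε : ℝ} (hε : 0 < ε) :
    ∃ M, 0 ≤ M ∧ ∀ᶠ n in atTop, (μ n).real {ω | ¬ |Z n ω| ≤ M * r n ω} ≤ ε := by
  obtain ⟨M, hM⟩ := h ε hε
  refine ⟨|M|, abs_nonneg M, ?_⟩
  filter_upwards [hM] with n hn
  refine (measureReal_mono fun ω hω => ?_).trans hn
  have h1 := mul_le_mul_of_nonneg_right (le_abs_self M) (hr n ω)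
  have h2 : |M| * r n ω < |Z n ω| := not_le.1 hω
  exact h1.trans_lt h2

theorem exists_bound_forall {K : ℕ} {Z : Fin K → ∀ n, Ω n → ℝ} {r : ∀ n, Ω n → ℝ}
    (h : ∀ k, IsBigOP μ (Z k) r) (hr : ∀ n ω, 0 ≤ r n ω) {ε : ℝ} (hε : 0 < ε) :
    ∃ M, 0 ≤ M ∧ ∀ᶠ n in atTop, (μ n).real {ω | ¬ ∀ k, |Z k n ω| ≤ M * r n ω} ≤ ε := by
  have hδ : 0 < ε / (K + 1) := by positivity
  choose M hM0 hM using fun k => (h k).exists_bound hr hδ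
  refine ⟨∑ k, M k, Finset.sum_nonneg fun k _ => hM0 k, ?_⟩
  filter_upwards [eventually_all.2 hM] with n hn
  refine (measureReal_not_forall_le _ _).trans ?_
  have h1 : ∀ k ∈ Finset.univ, (μ n).real {ω | ¬ |Z k n ω| ≤ (∑ k, M k) * r n ω}
      ≤ ε / (K + 1) := fun k _ => by
    refine le_trans (measureReal_mono ?_) (hn k)
    intro ω hω hle
    refine hω (hle.trans ?_)
    exact mul_le_mul_of_nonneg_right
      (Finset.single_le_sum (fun k _ => hM0 k) (Finset.mem_univ k)) (hr n ω)
  refine (Finset.sum_le_card_nsmul _ _ _ h1).trans ?_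
  rw [Finset.card_univ, Fintype.card_fin, nsmul_eq_mul, mul_div_assoc', div_le_iff₀ (by positivity)]
  nlinarith

/-- Where `|r| ≤ M`, the random rate is at most `1 + M`, so tolerance `η / (1 + M)` suffices. -/
theorem IsLittleOP.of_one_add {Z r : ∀ n, Ω n → ℝ} (h : IsLittleOP μ Z fun n ω => 1 + r n ω)
    (hr : IsBigOP μ r fun _ _ => 1) : IsLittleOP μ Z fun _ _ => 1 := by
  intro η hη
  refine tendsto_zero_of_forall_eventually_le (fun n => measureReal_nonneg) fun ε hε => ?_
  obtain ⟨M, hM0, hM⟩ := hr.exists_bound (fun _ _ => zero_le_one) (half_pos hε)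
  have h1 := h (η / (1 + M)) (by positivity)
  have h2 : ∀ᶠ n in atTop, (μ n).real {ω | ¬ |Z n ω| ≤ η / (1 + M) * (1 + r n ω)} ≤ ε / 2 := by
    filter_upwards [h1.eventually (gt_mem_nhds (half_pos hε))] with n hn
    simpa only [not_le] using hn.le
  have h3 := eventually_le_of_imp (B := fun n ω => |Z n ω| ≤ η * 1) (eventually_and_le h2 hM)
    (Eventually.of_forall fun n ω hω => by
      refine hω.1.trans ?_
      have h4 : 1 + r n ω ≤ 1 + M := by linarith [hω.2, le_abs_self (r n ω)]
      calc η / (1 + M) * (1 + r n ω) ≤ η / (1 + M) * (1 + M) := by gcongr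
        _ = η * 1 := by field_simp)
  simpa only [not_le, add_halves] using h3

end Probability

/-! ### Samples are regular with high probability -/

section Regularity

open scoped Matrix.Norms.L2Operator

variable {Ω : ℕ → Type*} [∀ n, MeasurableSpace (Ω n)] {μ : ∀ n, Measure (Ω n)}
  [∀ n, IsProbabilityMeasure (μ n)] {K R : ℕ} {N T : ℕ → ℕ}

theorem StrongGram.exists_bound {m : ℕ → ℕ} {A : ∀ n, Ω n → Matrix (Fin (m n)) (Fin R) ℝ}
    (h : StrongGram μ A) (hm : Tendsto m atTop atTop) :
    ∃ B, 0 ≤ B ∧ ∀ ε > 0, ∀ᶠ n in atTop, (μ n).real {ω | ¬ (IsUnit ((A n ω)ᵀ * A n ω).det ∧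
      ‖((A n ω)ᵀ * A n ω)⁻¹‖ ≤ B / m n)} ≤ ε := by
  obtain ⟨S, hS, hlim⟩ := h
  have hSu : IsUnit S.det := hS.det_pos.ne'.isUnit
  refine ⟨2 * ‖S⁻¹‖, by positivity, fun ε hε => ?_⟩
  -- Times `‖S⁻¹‖` this is below `1 / 2`; the `+ 2` keeps it meaningful when `‖S⁻¹‖ = 0`, as for `R
  -- = 0`.
  have hη : 0 < 1 / (2 * ‖S⁻¹‖ + 2) := by positivity
  have h1 : ∀ᶠ n in atTop, (μ n).real {ω | ¬ |specNorm ((1 / (m n : ℝ)) • ((A n ω)ᵀ * A n ω) - S)|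
      ≤ 1 / (2 * ‖S⁻¹‖ + 2) * 1} ≤ ε := by
    filter_upwards [(hlim _ hη).eventually (gt_mem_nhds hε)] with n hn
    simpa only [not_le] using hn.le
  refine eventually_le_of_imp h1 ?_
  filter_upwards [hm.eventually_gt_atTop 0] with n hn ω hω
  have hm0 : (0 : ℝ) < m n := by exact_mod_cast hn
  set G := (A n ω)ᵀ * A n ω with hG
  have h2 : ‖(1 / (m n : ℝ)) • G - S‖ ≤ 1 / (2 * ‖S⁻¹‖ + 2) := by
    simpa [specNorm] using hω
  obtain ⟨h3, h4⟩ := isUnit_det_and_norm_inv_le hSu (A := (1 / (m n : ℝ)) • G) (by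
    refine (mul_le_mul_of_nonneg_left h2 (norm_nonneg _)).trans ?_
    rw [mul_one_div, div_le_div_iff₀ (by positivity) (by positivity)]
    linarith)
  have hGu : IsUnit G.det := by
    rw [Matrix.det_smul] at h3
    exact isUnit_of_mul_isUnit_right h3
  refine ⟨hGu, ?_⟩
  have h5 : G⁻¹ = (1 / (m n : ℝ)) • ((1 / (m n : ℝ)) • G)⁻¹ := by
    refine Matrix.inv_eq_right_inv ?_
    rw [Matrix.mul_smul, ← Matrix.smul_mul, Matrix.mul_nonsing_inv _ h3]
  rw [h5, norm_smul, Real.norm_eq_abs, abs_of_pos (by positivity), one_div_mul_eq_div]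
  exact div_le_div_of_nonneg_right h4 hm0.le

theorem norm_factorPinv_le_of_gram {N T : ℕ} {lam : Matrix (Fin N) (Fin R) ℝ}
    {f : Matrix (Fin T) (Fin R) ℝ} {A B : ℝ} (hA : 0 ≤ A) (hB : 0 ≤ B)
    (hl : IsUnit (lamᵀ * lam).det) (hf : IsUnit (fᵀ * f).det)
    (hln : ‖(lamᵀ * lam)⁻¹‖ ≤ A / N) (hfn : ‖(fᵀ * f)⁻¹‖ ≤ B / T) :
    ‖factorPinv lam f‖ ≤ √(A * B) / √((N : ℝ) * T) := by
  rw [← Real.sqrt_div (by positivity)]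
  refine Real.le_sqrt_of_sq_le ((norm_factorPinv_sq_le hl hf).trans ?_)
  refine (mul_le_mul hfn hln (norm_nonneg _) (by positivity)).trans (le_of_eq ?_)
  rw [div_mul_div_comm, mul_comm B A, mul_comm (T : ℝ)]

theorem tendsto_sqrt_sqrt_size (hN : Tendsto N atTop atTop) (hT : Tendsto T atTop atTop) :
    Tendsto (fun n => √√((N n : ℝ) * T n)) atTop atTop := by
  refine Real.tendsto_sqrt_atTop.comp (Real.tendsto_sqrt_atTop.comp ?_)
  exact (tendsto_natCast_atTop_atTop.comp hN).atTop_mul_atTop₀ (tendsto_natCast_atTop_atTop.comp hT)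

/-- Eventually `N/T` lies between `κ²/2` and `2κ²`, so `N²` and `T²` are bounded by multiples of
`NT`. This turns the rate of `‖e‖` into `(NT)^(1/4)`. -/
theorem eventually_max_le (hN : Tendsto N atTop atTop) (hT : Tendsto T atTop atTop) {κ : ℝ}
    (hκ : 0 < κ) (hNT : Tendsto (fun n => (N n : ℝ) / (T n : ℝ)) atTop (𝓝 (κ ^ 2))) :
    ∃ ρ, 0 ≤ ρ ∧ ∀ᶠ n in atTop, √(max (N n : ℝ) (T n)) ≤ ρ * √√((N n : ℝ) * T n) := by
  have hκ2 : 0 < κ ^ 2 := by positivity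
  refine ⟨√(√(2 * κ ^ 2) + √(2 / κ ^ 2)), Real.sqrt_nonneg _, ?_⟩
  filter_upwards [hN.eventually_gt_atTop 0, hT.eventually_gt_atTop 0,
    hNT.eventually (gt_mem_nhds (show κ ^ 2 < 2 * κ ^ 2 by linarith)),
    hNT.eventually (lt_mem_nhds (show κ ^ 2 / 2 < κ ^ 2 by linarith))] with n hN0 hT0 h1 h2
  have hN' : (0 : ℝ) < N n := by exact_mod_cast hN0
  have hT' : (0 : ℝ) < T n := by exact_mod_cast hT0
  rw [div_lt_iff₀ hT'] at h1
  rw [lt_div_iff₀ hT'] at h2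
  rw [← Real.sqrt_mul (by positivity)]
  refine Real.sqrt_le_sqrt ?_
  have hs0 : 0 ≤ √((N n : ℝ) * T n) := Real.sqrt_nonneg _
  have e1 : (N n : ℝ) ≤ √(2 * κ ^ 2) * √((N n : ℝ) * T n) := by
    rw [← Real.sqrt_mul (by positivity)]
    refine Real.le_sqrt_of_sq_le ?_
    nlinarith
  have e2 : (T n : ℝ) ≤ √(2 / κ ^ 2) * √((N n : ℝ) * T n) := by
    rw [← Real.sqrt_mul (by positivity)]
    refine Real.le_sqrt_of_sq_le ?_
    rw [div_mul_eq_mul_div, le_div_iff₀ hκ2]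
    nlinarith
  have p1 : 0 ≤ √(2 * κ ^ 2) * √((N n : ℝ) * T n) := by positivity
  have p2 : 0 ≤ √(2 / κ ^ 2) * √((N n : ℝ) * T n) := by positivity
  rw [add_mul]
  exact max_le (by linarith) (by linarith)

/-- Under the assumptions, samples are regular with probability close to one. -/
theorem exists_regularSample (hN : Tendsto N atTop atTop) (hT : Tendsto T atTop atTop) {κ : ℝ}
    (hκ : 0 < κ) (hNT : Tendsto (fun n => (N n : ℝ) / (T n : ℝ)) atTop (𝓝 (κ ^ 2)))
    {X : ∀ n, Ω n → Fin K → Matrix (Fin (N n)) (Fin (T n)) ℝ}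
    {lam : ∀ n, Ω n → Matrix (Fin (N n)) (Fin R) ℝ}
    {f : ∀ n, Ω n → Matrix (Fin (T n)) (Fin R) ℝ}
    {e : ∀ n, Ω n → Matrix (Fin (N n)) (Fin (T n)) ℝ}
    (hSF : AssumptionSF μ lam f) (hSN : AssumptionSN μ X e) (hEX : AssumptionEX μ X e)
    (hNC : AssumptionNC μ R R X) :
    ∃ b > 0, ∀ ε > 0, ∃ x c t a : ℝ, 0 ≤ x ∧ 0 ≤ c ∧ 0 ≤ t ∧ 0 ≤ a ∧
      ∀ᶠ n in atTop, (μ n).real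
        {ω | ¬ RegularSample (X n ω) (lam n ω) (f n ω) (e n ω) b x c t a} ≤ ε := by
  obtain ⟨b, hb, hNC⟩ := hNC
  obtain ⟨A, hA0, hA⟩ := hSF.1.exists_bound hN
  obtain ⟨B, hB0, hB⟩ := hSF.2.exists_bound hT
  obtain ⟨ρ, hρ0, hρ⟩ := eventually_max_le hN hT hκ hNT
  refine ⟨b, hb, fun ε hε => ?_⟩
  -- Six events: two Gram matrices, `‖X_k‖`, `‖e‖`, `Tr(X_k e')` and noncollinearity.
  have hε6 : 0 < ε / 6 := by positivity
  obtain ⟨x, hx0, hx⟩ := exists_bound_forall hSN.1 (fun _ _ => Real.sqrt_nonneg _) hε6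
  obtain ⟨M, hM0, hM⟩ := hSN.2.exists_bound (fun _ _ => Real.sqrt_nonneg _) hε6
  obtain ⟨t, ht0, ht⟩ := exists_bound_forall hEX (fun _ _ => zero_le_one) hε6
  refine ⟨x, M * ρ, t, √(A * B), hx0, by positivity, ht0, Real.sqrt_nonneg _, ?_⟩
  have hall := eventually_and_le (hA _ hε6) (eventually_and_le (hB _ hε6) (eventually_and_le hx
    (eventually_and_le hM (eventually_and_le ht (hNC.eventually_le hε6)))))
  have hsum : ε / 6 + (ε / 6 + (ε / 6 + (ε / 6 + (ε / 6 + ε / 6)))) = ε := by ring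
  rw [hsum] at hall
  refine eventually_le_of_imp hall ?_
  filter_upwards [hρ, (tendsto_sqrt_sqrt_size hN hT).eventually_ge_atTop 1] with n hn hsize ω hω
  obtain ⟨⟨hl, hln⟩, ⟨hf, hfn⟩, hXω, heω, htω, hNCω⟩ := hω
  have hs1 : 1 ≤ √((N n : ℝ) * T n) := Real.one_le_sqrt.1 hsize
  have hs0 : 0 < √((N n : ℝ) * T n) := by linarith
  refine ⟨hs1, hl, hf, fun k => ?_, ?_, fun k => ?_,
    norm_factorPinv_le_of_gram hA0 hB0 hl hf hln hfn, hNCω⟩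
  · exact (le_abs_self _).trans (hXω k)
  · refine (le_abs_self _).trans (heω.trans ?_)
    rw [mul_assoc]
    exact mul_le_mul_of_nonneg_left hn hM0
  · have h1 := htω k
    rw [abs_mul, abs_of_pos (by positivity), one_div_mul_eq_div, mul_one, div_le_iff₀ hs0,
      Matrix.trace_mul_comm] at h1
    exact h1

end Regularity

end Panel

/-! ### The asymptotic expansion -/

theorem corollary4p3 {Ω : ℕ → Type*} [∀ n, MeasurableSpace (Ω n)]
    (μ : ∀ n, Measure (Ω n)) [∀ n, IsProbabilityMeasure (μ n)]
    (K R₀ : ℕ) (N T : ℕ → ℕ)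
    (hN : Tendsto N atTop atTop) (hT : Tendsto T atTop atTop)
    (κ : ℝ) (hκ : 0 < κ)
    (hNT : Tendsto (fun n => (N n : ℝ) / (T n : ℝ)) atTop (𝓝 (κ ^ 2)))
    (β₀ : Fin K → ℝ)
    (X : ∀ n, Ω n → Fin K → Matrix (Fin (N n)) (Fin (T n)) ℝ)
    (lam : ∀ n, Ω n → Matrix (Fin (N n)) (Fin R₀) ℝ)
    (f : ∀ n, Ω n → Matrix (Fin (T n)) (Fin R₀) ℝ)
    (e : ∀ n, Ω n → Matrix (Fin (N n)) (Fin (T n)) ℝ)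
    (hSF : Panel.AssumptionSF μ lam f)
    (hSN : Panel.AssumptionSN μ X e)
    (hEX : Panel.AssumptionEX μ X e)
    (hNC : Panel.AssumptionNC μ R₀ R₀ X)
    (Y : ∀ n, Ω n → Matrix (Fin (N n)) (Fin (T n)) ℝ)
    (hY : ∀ n ω, Y n ω = Panel.outcome β₀ (X n ω) (lam n ω) (f n ω) (e n ω))
    -- `βhat` is a least squares estimator with `R₀` factors, wherever a minimizer exists
    (βhat : ∀ n, Ω n → Fin K → ℝ)
    (hβhat : ∀ n, ∀ᵐ ω ∂(μ n), (∃ β, Panel.IsLSEstimate R₀ (Y n ω) (X n ω) β) →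
      Panel.IsLSEstimate R₀ (Y n ω) (X n ω) (βhat n ω))
    (c₁ c₂ : ∀ n, Ω n → Fin K → ℝ)
    (hc₁ : ∀ n ω, c₁ n ω = Panel.C1 (X n ω) (lam n ω) (f n ω) (e n ω))
    (hc₂ : ∀ n ω, c₂ n ω = Panel.C2 (X n ω) (lam n ω) (f n ω) (e n ω))
    (W : ∀ n, Ω n → Matrix (Fin K) (Fin K) ℝ)
    (hW : ∀ n ω, W n ω = Panel.Wmat (X n ω) (lam n ω) (f n ω)) :
    Panel.WPA1 μ (fun n ω => IsUnit (W n ω)) ∧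
    Panel.IsLittleOP μ
      (fun n ω => Panel.vecNorm (√((N n : ℝ) * T n) • (βhat n ω - β₀)
        - (W n ω)⁻¹ *ᵥ (c₁ n ω + c₂ n ω)))
      (fun n ω => 1 + Panel.vecNorm (c₁ n ω)) ∧
    (Panel.IsBigOP μ (fun n ω => Panel.vecNorm (c₁ n ω)) (fun _ _ => 1) →
      Panel.IsLittleOP μ
        (fun n ω => Panel.vecNorm (√((N n : ℝ) * T n) • (βhat n ω - β₀)
          - (W n ω)⁻¹ *ᵥ (c₁ n ω + c₂ n ω)))
        (fun _ _ => 1) ∧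
      Panel.IsBigOP μ
        (fun n ω => Panel.vecNorm (√((N n : ℝ) * T n) • (βhat n ω - β₀))) (fun _ _ => 1)) := by
  obtain ⟨b, hb, hreg⟩ := Panel.exists_regularSample hN hT hκ hNT hSF hSN hEX hNC
  have hlim := Panel.tendsto_sqrt_sqrt_size hN hT
  -- The estimator is a minimizer only where one exists; regular samples guarantee existence.
  have hLS : ∀ n ω {x c t a : ℝ},
      Panel.RegularSample (X n ω) (lam n ω) (f n ω) (e n ω) b x c t a →
      ((∃ β, Panel.IsLSEstimate R₀ (Y n ω) (X n ω) β) →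
        Panel.IsLSEstimate R₀ (Y n ω) (X n ω) (βhat n ω)) →
      Panel.IsLSEstimate R₀ (Panel.outcome β₀ (X n ω) (lam n ω) (f n ω) (e n ω)) (X n ω)
        (βhat n ω) := fun n ω x c t a h h' => by
    rw [← hY]
    exact h' (h.exists_estimate hb _)
  have hlittle : Panel.IsLittleOP μ
      (fun n ω => Panel.vecNorm (√((N n : ℝ) * T n) • (βhat n ω - β₀)
        - (W n ω)⁻¹ *ᵥ (c₁ n ω + c₂ n ω)))
      (fun n ω => 1 + Panel.vecNorm (c₁ n ω)) := by
    intro η hη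
    refine Panel.tendsto_zero_of_forall_eventually_le (fun n => measureReal_nonneg) fun ε hε => ?_
    obtain ⟨x, c, t, a, hx, hc, ht, ha, hev⟩ := hreg ε hε
    obtain ⟨H, s₀, hH⟩ := Panel.exists_expansion_constants K R₀ hb hx hc ht ha
    -- With `ε` fixed, `H` and `s₀` are constants, so `H / √√(NT)` eventually drops below `η`.
    have h1 := Panel.eventually_le_of_imp (B := fun n ω =>
        |Panel.vecNorm (√((N n : ℝ) * T n) • (βhat n ω - β₀)
          - (W n ω)⁻¹ *ᵥ (c₁ n ω + c₂ n ω))| ≤ η * (1 + Panel.vecNorm (c₁ n ω)))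
      (Panel.eventually_and_ae hev hβhat) (by
        filter_upwards [hlim.eventually_ge_atTop s₀,
          (hlim.const_div_atTop H).eventually (gt_mem_nhds hη)] with n hn1 hn2 ω hω
        rw [abs_of_nonneg (Panel.vecNorm_nonneg _), hW, hc₁, hc₂]
        refine (hH hω.1 hn1 (hLS n ω hω.1 hω.2)).trans ?_
        exact mul_le_mul_of_nonneg_right hn2.le
          (add_nonneg zero_le_one (Panel.vecNorm_nonneg _)))
    simpa only [not_le] using h1
  refine ⟨?_, hlittle, fun hC1 => ?_⟩
  · refine Panel.tendsto_zero_of_forall_eventually_le (fun n => measureReal_nonneg) fun ε hε => ?_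
    obtain ⟨x, c, t, a, -, -, -, -, hev⟩ := hreg ε hε
    exact Panel.eventually_le_of_imp hev (Eventually.of_forall fun n ω h => by
      rw [hW]; exact h.isUnit_Wmat hb)
  · have hone := hlittle.of_one_add hC1
    refine ⟨hone, fun ε hε => ?_⟩
    have hε3 : 0 < ε / 3 := by positivity
    obtain ⟨x, c, t, a, hx, hc, ht, ha, hev⟩ := hreg _ hε3
    obtain ⟨M, hM0, hM⟩ := hC1.exists_bound (fun _ _ => zero_le_one) hε3
    have hev1 : ∀ᶠ n in atTop, (μ n).real {ω | ¬
        |Panel.vecNorm (√((N n : ℝ) * T n) • (βhat n ω - β₀)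
          - (W n ω)⁻¹ *ᵥ (c₁ n ω + c₂ n ω))| ≤ 1 * 1} ≤ ε / 3 := by
      filter_upwards [(hone 1 one_pos).eventually (gt_mem_nhds hε3)] with n hn
      simpa only [not_le] using hn.le
    -- The expansion error is at most 1, `W⁻¹` has norm at most `b⁻¹`, `M` bounds `C⁽¹⁾`, and the
    -- last term is the deterministic bound on `C⁽²⁾`.
    refine ⟨1 + b⁻¹ * (M + K * (18 * R₀ * x * a * c ^ 2)), ?_⟩
    have h1 := Panel.eventually_le_of_imp (B := fun n ω =>
        |Panel.vecNorm (√((N n : ℝ) * T n) • (βhat n ω - β₀))|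
          ≤ (1 + b⁻¹ * (M + K * (18 * R₀ * x * a * c ^ 2))) * 1)
      (Panel.eventually_and_le hev1 (Panel.eventually_and_le hM hev))
      (Eventually.of_forall fun n ω hω => by
        obtain ⟨hz, hm, hr⟩ := hω
        rw [abs_of_nonneg (Panel.vecNorm_nonneg _), mul_one] at hz hm ⊢
        have h2 : √((N n : ℝ) * T n) • (βhat n ω - β₀)
            = (√((N n : ℝ) * T n) • (βhat n ω - β₀) - (W n ω)⁻¹ *ᵥ (c₁ n ω + c₂ n ω))
              + (W n ω)⁻¹ *ᵥ (c₁ n ω + c₂ n ω) := by abel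
        rw [h2]
        refine (Panel.vecNorm_add_le _ _).trans (add_le_add hz ?_)
        rw [hW]
        refine (hr.vecNorm_inv_Wmat_mulVec_le hb _).trans ?_
        refine mul_le_mul_of_nonneg_left ((Panel.vecNorm_add_le _ _).trans (add_le_add hm ?_))
          (inv_nonneg.2 hb.le)
        rw [hc₂]
        exact hr.vecNorm_C2_le)
    have hsum : ε / 3 + (ε / 3 + ε / 3) = ε := by ring
    rw [hsum] at h1
    simpa only [not_le] using h1
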